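/- Conventions. For a prime $p$ and a non-zero integer $a$ write $a=\bar a p^{\alpha}$ with $p\nmid \bar a$. For non-zero integers $a=\bar a p^{\alpha}$, $b=\bar b p^{\beta}$ the Hilbert symbol is $$(a,b)_p=\left(\tfrac{-1}{p}\right)^{\alpha\beta}\left(\tfrac{\bar a}{p}\right)^{\beta}\left(\tfrac{\bar b}{p}\right)^{\alpha}\ (p>2),\qquad (a,b)_2=(-1)^{(\bar a-1)(\bar b-1)/4+\alpha(\bar b^2-1)/8+\beta(\bar a^2-1)/8},$$ and $(a,b)_\infty=-1$ if $a,b<0$ and $(a,b)_\infty=1$ otherwise; for non-zero rationals, $(m/n,m'/n')_p=(mn,m'n')_p$. An $n\times n$ rational matrix $X$ is nondegenerate if for each $i\in\{1,\dots,n\}$ the submatrix $X_i$ in its first $i$ rows and columns is invertible, and then its Hasse–Minkowski invariant is $$C_p(X)=(-1,-|X_n|)_p\prod_{i=1}^{n-1}(|X_i|,-|X_{i+1}|)_p ,$$ where $|\cdot|$ is the determinant. For $n\ge 3$, $B_n(a)$ is the $n\times n$ matrix with $a$ on the diagonal, $1$ in the positions $(i,j)$ with $i-j\equiv\pm1 \pmod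 n$ and $0$ elsewhere, and $B_2(a)=\begin{pmatrix}a&2\\2&a\end{pmatrix}$. $J_v$ is the all-ones $v\times v$ matrix. Statement. Let $v,k,\lambda$ be positive integers with $\lambda+2<k<v$, let $p$ be a prime or $p=\infty$, let $c_1,\dots,c_t\ge 2$ be integers with $c_1+\dots+c_t=v$, and let $e=|\{i: c_i\text{ is even}\}|$. Put $$X=X_{(v,k,\lambda)}[c_1,\dots,c_t]=\mathrm{diag}\bigl(B_{c_1}(k-\lambda),\dots,B_{c_t}(k-\lambda)\bigr)+\lambda J_v .$$ If $|X|$ is a perfect square, then $X$ and all the $B_{c_i}(k-\lambda)$ are nondegenerate (so that their invariants are defined) and $$C_p(X)=f_p(k-\lambda,\lambda,t,e)\prod_{i=1}^t C_p(B_{c_i}(k-\lambda)),$$ where $$f_p(a,\lambda,t,e)=(-1,-1)_p^{\,t-1}\,(a+2,-1)_p^{\binom{t-e}{2}}\,(a^2-4,-1)_p^{\binom e2}\,(a+2,a^2-4)_p^{\,e(t-e)}\,\bigl(-\lambda,(a+2)^t(a-2)^e\bigr)_p .$$ -/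

import Mathlib

/-- A place of `ℚ`: a prime `p`, or `∞`. -/
inductive RatPlace where
  | prime (p : Nat.Primes)
  | infinity

/-- For `n ≠ 0` with `p`-factorisation `n = n̄ p ^ α`, this is the `p`-free part `n̄`. -/
def primeFreePart (p : ℕ) (n : ℤ) : ℤ := n / (p : ℤ) ^ padicValInt p n

/-- The Hilbert symbol `(a, b)_p` of non-zero integers `a`, `b` at an odd prime `p`. -/
def hilbertOdd (p : ℕ) [Fact p.Prime] (a b : ℤ) : ℤ :=
  legendreSym p (-1) ^ (padicValInt p a * padicValInt p b) *
    legendreSym p (primeFreePart p a) ^ padicValInt p b *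
    legendreSym p (primeFreePart p b) ^ padicValInt p a

/-- The Hilbert symbol `(a, b)_2` of non-zero integers `a`, `b`. The three integer divisions are
exact, because the `2`-free parts of `a` and `b` are odd. -/
def hilbertTwo (a b : ℤ) : ℤ :=
  (Int.negOnePow
    ((primeFreePart 2 a - 1) * (primeFreePart 2 b - 1) / 4 +
      (padicValInt 2 a : ℤ) * ((primeFreePart 2 b ^ 2 - 1) / 8) +
      (padicValInt 2 b : ℤ) * ((primeFreePart 2 a ^ 2 - 1) / 8)) : ℤˣ)

/-- The Hilbert symbol `(a, b)_∞` of non-zero integers `a`, `b`. -/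
def hilbertInfinity (a b : ℤ) : ℤ := if a < 0 ∧ b < 0 then -1 else 1

/-- The Hilbert symbol `(a, b)_p` of non-zero integers `a`, `b`, for `p` a prime or `∞`. -/
def hilbertSymbol : RatPlace → ℤ → ℤ → ℤ
  | .prime p, a, b =>
      haveI : Fact (p : ℕ).Prime := ⟨p.2⟩
      if (p : ℕ) = 2 then hilbertTwo a b else hilbertOdd p a b
  | .infinity, a, b => hilbertInfinity a b

/-- The Hilbert symbol of non-zero rationals. A Hilbert symbol depends only on the square classes
of its arguments, and `x = m / n` has the square class of the integer `m * n`; if `x` is an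
integer, then `m = x` and `n = 1`. -/
def hilbertSymbolRat (p : RatPlace) (x y : ℚ) : ℤ :=
  hilbertSymbol p (x.num * (x.den : ℤ)) (y.num * (y.den : ℤ))

/-- The determinant of the submatrix of `X` in the first `i` rows and the first `i` columns. -/
def leadingMinor {n : ℕ} (X : Matrix (Fin n) (Fin n) ℚ) (i : ℕ) (hi : i ≤ n) : ℚ :=
  (X.submatrix (Fin.castLE hi) (Fin.castLE hi)).det

/-- All the leading principal submatrices of `X` of sizes `1, …, n` are invertible. -/
def IsNondegenerate {n : ℕ} (X : Matrix (Fin n) (Fin n) ℚ) : Prop :=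
  ∀ (i : ℕ) (hi : i ≤ n), 1 ≤ i → leadingMinor X i hi ≠ 0

/-- The Hasse-Minkowski invariant of a nondegenerate `n × n` rational matrix `X`:
`C_p(X) = (-1, -|X_n|)_p ∏_{i = 1}^{n - 1} (|X_i|, -|X_{i + 1}|)_p`.
(The index `i : Fin (n - 1)` below stands for `i + 1`.) -/
def hasseMinkowski (p : RatPlace) {n : ℕ} (X : Matrix (Fin n) (Fin n) ℚ) : ℤ :=
  hilbertSymbolRat p (-1) (-X.det) *
    ∏ i : Fin (n - 1),
      hilbertSymbolRat p
        (leadingMinor X (i.val + 1) (by omega))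
        (-leadingMinor X (i.val + 2) (by omega))

/-- The matrix `B_n(a)`, `n ≥ 2`: diagonal entries `a`; the off-diagonal entries are `2` if
`n = 2`, and if `n ≥ 3` they are `1` in cyclically adjacent positions and `0` elsewhere. -/
def cycleMatrix (n : ℕ) (a : ℤ) : Matrix (Fin n) (Fin n) ℤ :=
  Matrix.of fun i j =>
    if i = j then a
    else if n = 2 then 2
    else if i.val + 1 = j.val ∨ j.val + 1 = i.val ∨
        (i.val = 0 ∧ j.val + 1 = n) ∨ (j.val = 0 ∧ i.val + 1 = n) then 1
    else 0

/-- The `v × v` matrix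
`X_{(v,k,l)}[c_1, …, c_t] = diag(B_{c_1}(k - l), …, B_{c_t}(k - l)) + l J_v`,
where `v = c_1 + ⋯ + c_t`. The equivalence `finSigmaFinEquiv` lists the blocks in order. -/
def coveringMatrix (k l : ℕ) {t : ℕ} (c : Fin t → ℕ) :
    Matrix (Fin (∑ i, c i)) (Fin (∑ i, c i)) ℤ :=
  Matrix.reindex finSigmaFinEquiv finSigmaFinEquiv
      (Matrix.blockDiagonal' fun i : Fin t => cycleMatrix (c i) ((k : ℤ) - (l : ℤ))) +
    (l : ℤ) • Matrix.of fun _ _ => (1 : ℤ)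

/-- `f_p(a, l, t, e) = (-1, -1)_p^(t-1) (a+2, -1)_p^C(t-e, 2) (a²-4, -1)_p^C(e, 2)
(a+2, a²-4)_p^(e(t-e)) (-l, (a+2)^t (a-2)^e)_p`. -/
def coveringFactor (p : RatPlace) (a l : ℤ) (t e : ℕ) : ℤ :=
  hilbertSymbol p (-1) (-1) ^ (t - 1) *
    hilbertSymbol p (a + 2) (-1) ^ (t - e).choose 2 *
    hilbertSymbol p (a ^ 2 - 4) (-1) ^ e.choose 2 *
    hilbertSymbol p (a + 2) (a ^ 2 - 4) ^ (e * (t - e)) *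
    hilbertSymbol p (-l) ((a + 2) ^ t * (a - 2) ^ e)

/-! Hilbert symbols enter only through the rules of a symmetric Steinberg symbol with values `±1`,
verified place by place (`hilbertSymbolRat_isRatSymbol`).

Let `D` be the block diagonal part of `X`, so that `X = D + λJ`. In `D ⊥ ⟨λ⟩` replace the last
variable `s` by `s + x₁ + ⋯ + x_n`. The same form then has leading minors `|X₁|, …, |X_n|, λ|D_n|`.
Comparing its invariant in the two bases gives `hasseSeq_rank_one`; no general invariance theorem is
needed, since the induction on `n` changes only a binary subform at a time (`binary`). If `|X|` is a
square, the comparison becomes `C_p(X) = C_p(D) (-λ, |D|)_p` (`hasseSeq_add_const`).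

The invariant of an orthogonal sum is the product of the invariants, times `(-1,-1)_p` and the
symbol of the determinants (`hasseSeq_add`). By `exists_det_cycleMatrix`, with `a = k - λ`, the
block `B_c(a)` has determinant `a + 2` or `a² - 4` up to squares, for `c` odd or even. The pairwise
symbols of these classes and `(-λ, |D|)_p` make up `f_p`.

Nondegeneracy is positive definiteness: `B_c(a)` is `(a - 2)I` plus a Gram matrix, with `a > 2`, and
`λJ` is positive semidefinite. -/

/-! ### Hilbert symbols of integers as Steinberg symbols. -/

/-- A symmetric bimultiplicative sign-valued symbol on the non-zero integers for which a pair
`(-ac, -bc)` with `a + b + c = 0` has the value `1`. -/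
structure IsIntSymbol (h : ℤ → ℤ → ℤ) : Prop where
  mul_self : ∀ {a b : ℤ}, a ≠ 0 → b ≠ 0 → h a b * h a b = 1
  symm : ∀ a b : ℤ, h a b = h b a
  mul_left : ∀ {a a' b : ℤ}, a ≠ 0 → a' ≠ 0 → b ≠ 0 → h (a * a') b = h a b * h a' b
  neg_self : ∀ {a : ℤ}, a ≠ 0 → h a (-a) = 1
  steinberg : ∀ {a b c : ℤ}, a ≠ 0 → b ≠ 0 → c ≠ 0 → a + b + c = 0 →
    h (-(a * c)) (-(b * c)) = 1

/-- The Steinberg relation of a symbol follows from its case where `q` divides neither `a`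
nor `b`. -/
theorem IsIntSymbol.of_prime {h : ℤ → ℤ → ℤ} {q : ℕ} (hq : q.Prime)
    (mul_self : ∀ {a b : ℤ}, a ≠ 0 → b ≠ 0 → h a b * h a b = 1)
    (symm : ∀ a b : ℤ, h a b = h b a)
    (mul_left : ∀ {a a' b : ℤ}, a ≠ 0 → a' ≠ 0 → b ≠ 0 → h (a * a') b = h a b * h a' b)
    (neg_self : ∀ {a : ℤ}, a ≠ 0 → h a (-a) = 1)
    (core : ∀ {a b c : ℤ}, ¬ (q : ℤ) ∣ a → ¬ (q : ℤ) ∣ b → c ≠ 0 → a + b + c = 0 →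
      h (-(a * c)) (-(b * c)) = 1) : IsIntSymbol h where
  mul_self := mul_self
  symm := symm
  mul_left := mul_left
  neg_self := neg_self
  steinberg := by
    have sq : ∀ {g x y : ℤ}, g ≠ 0 → x ≠ 0 → y ≠ 0 → h (g * g * x) y = h x y := by
      intro g x y hg hx hy
      rw [mul_left (mul_ne_zero hg hg) hx hy, mul_left hg hg hy, mul_self hg hy, one_mul]
    -- The roles of `a` and `c` may be exchanged: `(-bc)(-ba)` is `ac` up to a square, and `ac` is
    -- trivial against `-ac`.
    have swap : ∀ {a b c : ℤ}, a ≠ 0 → b ≠ 0 → c ≠ 0 → h (-(c * a)) (-(b * a)) = 1 →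
        h (-(a * c)) (-(b * c)) = 1 := by
      intro a b c ha hb hc h1
      have e1 : h (b * b * (a * c)) (-(a * c)) = 1 := by
        rw [sq hb (mul_ne_zero ha hc) (neg_ne_zero.2 (mul_ne_zero ha hc)),
          neg_self (mul_ne_zero ha hc)]
      have e2 : b * b * (a * c) = -(b * c) * -(b * a) := by ring
      rw [e2, mul_left (neg_ne_zero.2 (mul_ne_zero hb hc)) (neg_ne_zero.2 (mul_ne_zero hb ha))
        (neg_ne_zero.2 (mul_ne_zero ha hc)), symm (-(b * a)), mul_comm a c, h1, mul_one,
        symm] at e1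
      rw [mul_comm a c, e1]
    -- Here `q` divides at most one of `a`, `b`, `c`, and `swap` brings that one into the place of
    -- `c`.
    have coprime : ∀ {a b c : ℤ}, a ≠ 0 → b ≠ 0 → c ≠ 0 → a + b + c = 0 → IsCoprime a b →
        h (-(a * c)) (-(b * c)) = 1 := by
      intro a b c ha hb hc habc hcop
      have hqp : Prime (q : ℤ) := Nat.prime_iff_prime_int.1 hq
      by_cases h1 : (q : ℤ) ∣ a
      · have h2 : ¬ (q : ℤ) ∣ b := fun h2 => hqp.not_isUnit (hcop.isUnit_of_dvd' h1 h2)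
        have h3 : ¬ (q : ℤ) ∣ c := fun h3 => h2 (by
          have : b = -a - c := by linarith
          rw [this]; exact dvd_sub (h1.neg_right) h3)
        exact swap ha hb hc (core h3 h2 ha (by linarith))
      · by_cases h2 : (q : ℤ) ∣ b
        · have h3 : ¬ (q : ℤ) ∣ c := fun h3 => h1 (by
            have : a = -b - c := by linarith
            rw [this]; exact dvd_sub (h2.neg_right) h3)
          rw [symm]
          exact swap hb ha hc (core h3 h1 hb (by linarith))
        · exact core h1 h2 hc habc
    intro a b c ha hb hc habc
    -- Removing the gcd `g` changes both arguments only by the factor `g²`.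
    obtain ⟨a', b', hcop, ha', hb'⟩ := Int.exists_gcd_one (m := a) (n := b)
      (Int.gcd_pos_of_ne_zero_left _ ha)
    generalize (a.gcd b : ℤ) = g at ha' hb'
    have hg : g ≠ 0 := by rintro rfl; simp at ha'; exact ha ha'
    have hc' : c = (-(a' + b')) * g := by rw [ha', hb'] at habc; linarith
    have ha0 : a' ≠ 0 := by rintro rfl; simp at ha'; exact ha ha'
    have hb0 : b' ≠ 0 := by rintro rfl; simp at hb'; exact hb hb'
    have hc0 : -(a' + b') ≠ 0 := by intro h0; rw [h0] at hc'; simp at hc'; exact hc hc'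
    generalize -(a' + b') = c' at hc' hc0
    have hs : a' + b' + c' = 0 := by
      have : g * (a' + b' + c') = 0 := by rw [← habc, ha', hb', hc']; ring
      simpa [hg] using this
    have e1 : -(a * c) = g * g * (-(a' * c')) := by rw [ha', hc']; ring
    have e2 : -(b * c) = g * g * (-(b' * c')) := by rw [hb', hc']; ring
    have n1 : -(a' * c') ≠ 0 := neg_ne_zero.2 (mul_ne_zero ha0 hc0)
    have n2 : -(b' * c') ≠ 0 := neg_ne_zero.2 (mul_ne_zero hb0 hc0)
    rw [e1, e2, sq hg n1 (mul_ne_zero (mul_ne_zero hg hg) n2), symm, sq hg n2 n1, symm]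
    exact coprime ha0 hb0 hc0 hs (Int.isCoprime_iff_gcd_eq_one.2 hcop)

section PrimeFreePart

variable {p : ℕ} [Fact p.Prime]

omit [Fact p.Prime] in
theorem pow_mul_primeFreePart (a : ℤ) : (p : ℤ) ^ padicValInt p a * primeFreePart p a = a :=
  Int.mul_ediv_cancel' (padicValInt_dvd a)

theorem not_dvd_primeFreePart {a : ℤ} (ha : a ≠ 0) : ¬ (p : ℤ) ∣ primeFreePart p a := by
  rintro ⟨m, hm⟩
  have h1 := pow_mul_primeFreePart (p := p) a
  rw [hm, ← mul_assoc, ← pow_succ] at h1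
  have h2 : (p : ℤ) ^ (padicValInt p a + 1) ∣ a := ⟨m, h1.symm⟩
  rw [padicValInt_dvd_iff] at h2
  rcases h2 with h2 | h2
  · exact ha h2
  · omega

theorem padicValInt_pow_mul {k : ℕ} {m : ℤ} (hm : ¬ (p : ℤ) ∣ m) :
    padicValInt p ((p : ℤ) ^ k * m) = k := by
  have hp : (p : ℤ) ≠ 0 := by exact_mod_cast (Fact.out : p.Prime).ne_zero
  have hm0 : m ≠ 0 := by rintro rfl; simp at hm
  rw [padicValInt.mul (pow_ne_zero _ hp) hm0, padicValInt.eq_zero_of_not_dvd hm]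
  have : padicValInt p ((p : ℤ) ^ k) = k := by
    rw [← Nat.cast_pow, padicValInt.of_nat, padicValNat.prime_pow]
  omega

theorem primeFreePart_pow_mul {k : ℕ} {m : ℤ} (hm : ¬ (p : ℤ) ∣ m) :
    primeFreePart p ((p : ℤ) ^ k * m) = m := by
  have hp : (p : ℤ) ≠ 0 := by exact_mod_cast (Fact.out : p.Prime).ne_zero
  rw [primeFreePart, padicValInt_pow_mul hm, Int.mul_ediv_cancel_left _ (pow_ne_zero _ hp)]

theorem primeFreePart_mul {a b : ℤ} (ha : a ≠ 0) (hb : b ≠ 0) :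
    primeFreePart p (a * b) = primeFreePart p a * primeFreePart p b := by
  have hp : Prime (p : ℤ) := Nat.prime_iff_prime_int.1 Fact.out
  have h : a * b = (p : ℤ) ^ (padicValInt p a + padicValInt p b) *
      (primeFreePart p a * primeFreePart p b) := by
    conv_lhs => rw [← pow_mul_primeFreePart (p := p) a, ← pow_mul_primeFreePart (p := p) b]
    ring
  rw [h, primeFreePart_pow_mul]
  intro h
  rcases hp.dvd_or_dvd h with h | h
  · exact not_dvd_primeFreePart ha h
  · exact not_dvd_primeFreePart hb h

omit [Fact p.Prime] in
theorem padicValInt_neg (a : ℤ) : padicValInt p (-a) = padicValInt p a := by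
  simp [padicValInt]

omit [Fact p.Prime] in
theorem primeFreePart_neg (a : ℤ) : primeFreePart p (-a) = -primeFreePart p a := by
  rw [primeFreePart, padicValInt_neg, primeFreePart]
  exact Int.neg_ediv_of_dvd (padicValInt_dvd a)

end PrimeFreePart

section Odd

variable {p : ℕ} [Fact p.Prime]

theorem legendreSym_mul_self_of_not_dvd {m : ℤ} (hm : ¬ (p : ℤ) ∣ m) :
    legendreSym p m * legendreSym p m = 1 := by
  rw [← sq, legendreSym.sq_one]
  rwa [Ne, ZMod.intCast_zmod_eq_zero_iff_dvd]

theorem not_dvd_neg_one : ¬ (p : ℤ) ∣ -1 := by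
  rw [dvd_neg]
  exact fun h => (Nat.prime_iff_prime_int.1 (Fact.out : p.Prime)).not_isUnit (isUnit_of_dvd_one h)

theorem hilbertOdd_isIntSymbol : IsIntSymbol (hilbertOdd p) := by
  have key : ∀ {m : ℤ} (k : ℕ), ¬ (p : ℤ) ∣ m → legendreSym p m ^ k * legendreSym p m ^ k = 1 := by
    intro m k hm
    rw [← mul_pow, legendreSym_mul_self_of_not_dvd hm, one_pow]
  refine IsIntSymbol.of_prime (q := p) Fact.out ?_ ?_ ?_ ?_ ?_
  · intro a b ha hb
    have h1 := key (padicValInt p a * padicValInt p b) (not_dvd_neg_one (p := p))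
    have h2 := key (padicValInt p b) (not_dvd_primeFreePart (p := p) ha)
    have h3 := key (padicValInt p a) (not_dvd_primeFreePart (p := p) hb)
    unfold hilbertOdd
    generalize legendreSym p (-1) ^ (padicValInt p a * padicValInt p b) = x at *
    generalize legendreSym p (primeFreePart p a) ^ padicValInt p b = y at *
    generalize legendreSym p (primeFreePart p b) ^ padicValInt p a = z at *
    linear_combination (y * y * z * z) * h1 + z * z * h2 + h3
  · intro a b
    unfold hilbertOdd
    rw [mul_comm (padicValInt p b)]
    ring
  · intro a a' b ha ha' hb
    unfold hilbertOdd
    rw [padicValInt.mul ha ha', primeFreePart_mul ha ha', legendreSym.mul]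
    ring
  · intro a ha
    have h1 := key (padicValInt p a * padicValInt p a + padicValInt p a)
      (not_dvd_neg_one (p := p))
    have h2 := key (padicValInt p a) (not_dvd_primeFreePart (p := p) ha)
    obtain ⟨r, hr⟩ : Even (padicValInt p a * padicValInt p a + padicValInt p a) := by
      have := Nat.even_mul_succ_self (padicValInt p a)
      rwa [Nat.mul_succ] at this
    unfold hilbertOdd
    rw [padicValInt_neg, primeFreePart_neg, neg_eq_neg_one_mul (primeFreePart p a),
      legendreSym.mul]
    have h3 := key r (not_dvd_neg_one (p := p))
    rw [← pow_add, ← hr, pow_add] at h3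
    rw [mul_pow]
    generalize legendreSym p (primeFreePart p a) ^ padicValInt p a = y at *
    linear_combination (y * y) * h3 + h2
  · intro a b c ha hb hc habc
    have hp : Prime (p : ℤ) := Nat.prime_iff_prime_int.1 Fact.out
    have hc1 := not_dvd_primeFreePart (p := p) hc
    have hc2 := pow_mul_primeFreePart (p := p) c
    set γ := padicValInt p c
    set d := primeFreePart p c
    have n1 : ¬ (p : ℤ) ∣ -(a * d) := by
      rw [dvd_neg]; intro h
      exact (hp.dvd_or_dvd h).elim ha hc1
    have n2 : ¬ (p : ℤ) ∣ -(b * d) := by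
      rw [dvd_neg]; intro h
      exact (hp.dvd_or_dvd h).elim hb hc1
    have e1 : -(a * c) = (p : ℤ) ^ γ * -(a * d) := by rw [← hc2]; ring
    have e2 : -(b * c) = (p : ℤ) ^ γ * -(b * d) := by rw [← hc2]; ring
    unfold hilbertOdd
    rw [e1, e2, padicValInt_pow_mul n1, padicValInt_pow_mul n2, primeFreePart_pow_mul n1,
      primeFreePart_pow_mul n2]
    rcases Nat.eq_zero_or_pos γ with h0 | h0
    · simp [h0]
    have hpc : (p : ℤ) ∣ c := by rw [← hc2]; exact dvd_mul_of_dvd_left (dvd_pow_self _ h0.ne') _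
    -- As `p ∣ c`, `b ≡ -a` modulo `p`. Up to squares only the power `γ² + γ` of the symbol of `-1`
    -- remains, and that exponent is even.
    have hab : legendreSym p b = legendreSym p (-1 * a) := by
      rw [legendreSym.mod p b, legendreSym.mod p (-1 * a)]
      congr 1
      apply Int.ModEq.symm
      rw [Int.modEq_iff_dvd]
      have : b - -1 * a = -c := by linarith
      rw [this]; exact hpc.neg_right
    rw [neg_eq_neg_one_mul (a * d), neg_eq_neg_one_mul (b * d)]
    simp only [legendreSym.mul, hab]
    obtain ⟨r, hr⟩ : Even (γ * γ + γ) := by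
      have := Nat.even_mul_succ_self γ
      rwa [Nat.mul_succ] at this
    have h1 := key r (not_dvd_neg_one (p := p))
    rw [← pow_add, ← hr, pow_add] at h1
    have h2 := key γ ha
    have h3 := key γ hc1
    have h4 := key γ (not_dvd_neg_one (p := p))
    simp only [mul_pow]
    generalize legendreSym p (-1) ^ (γ * γ) = w at *
    generalize legendreSym p (-1) ^ γ = x at *
    generalize legendreSym p a ^ γ = y at *
    generalize legendreSym p d ^ γ = z at *
    linear_combination (x * x * y * y * z * z) * h1 + (y * y * z * z) * h4 + z * z * h2 + h3

end Odd

theorem hilbertInfinity_isIntSymbol : IsIntSymbol hilbertInfinity where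
  mul_self := by intro a b _ _; unfold hilbertInfinity; split_ifs <;> simp
  symm := by intro a b; unfold hilbertInfinity; simp only [and_comm]
  mul_left := by
    intro a a' b ha ha' hb
    unfold hilbertInfinity
    rcases lt_or_gt_of_ne ha with h1 | h1 <;> rcases lt_or_gt_of_ne ha' with h2 | h2 <;>
    rcases lt_or_gt_of_ne hb with h3 | h3 <;>
    simp [h1, h2, h3, h1.le, h2.le, h3.le, mul_neg_of_neg_of_pos,
      mul_neg_of_pos_of_neg, not_lt.2, mul_nonneg_of_nonpos_of_nonpos]
  neg_self := by intro a ha; unfold hilbertInfinity; rw [if_neg]; omega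
  steinberg := by
    intro a b c ha hb hc h
    unfold hilbertInfinity
    rw [if_neg]
    rintro ⟨h1, h2⟩
    have h3 : c = -(a + b) := by linarith
    subst h3
    nlinarith [mul_self_nonneg (a + b)]

section Two

/-- The exponent of `-1` in `hilbertTwo (2 ^ α * u) (2 ^ β * w)`. -/
def twoExponent (u w : ℤ) (α β : ℕ) : ℤ :=
  (u - 1) * (w - 1) / 4 + (α : ℤ) * ((w ^ 2 - 1) / 8) + (β : ℤ) * ((u ^ 2 - 1) / 8)

theorem hilbertTwo_eq (a b : ℤ) : hilbertTwo a b = (Int.negOnePow (twoExponent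
    (primeFreePart 2 a) (primeFreePart 2 b) (padicValInt 2 a) (padicValInt 2 b)) : ℤˣ) := rfl

theorem odd_of_not_two_dvd {m : ℤ} (h : ¬ ((2 : ℕ) : ℤ) ∣ m) : Odd m := by
  rw [← Int.not_even_iff_odd, even_iff_two_dvd]
  exact_mod_cast h

theorem odd_primeFreePart_two {a : ℤ} (ha : a ≠ 0) : Odd (primeFreePart 2 a) :=
  odd_of_not_two_dvd (not_dvd_primeFreePart ha)

theorem four_mul_div_of_odd {u w : ℤ} (hu : Odd u) (hw : Odd w) :
    4 * ((u - 1) * (w - 1) / 4) = (u - 1) * (w - 1) := by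
  obtain ⟨x, rfl⟩ := hu
  obtain ⟨y, rfl⟩ := hw
  exact Int.mul_ediv_cancel' ⟨x * y, by ring⟩

theorem eight_mul_div_of_odd {u : ℤ} (hu : Odd u) : 8 * ((u ^ 2 - 1) / 8) = u ^ 2 - 1 :=
  Int.mul_ediv_cancel' (Int.eight_dvd_sq_sub_one_of_odd hu)

theorem hilbertTwo_isIntSymbol : IsIntSymbol hilbertTwo := by
  have : Fact (Nat.Prime 2) := ⟨Nat.prime_two⟩
  refine IsIntSymbol.of_prime (q := 2) Nat.prime_two ?_ ?_ ?_ ?_ ?_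
  · intro a b _ _
    rw [hilbertTwo_eq, ← Units.val_mul, Int.units_mul_self, Units.val_one]
  · intro a b
    rw [hilbertTwo_eq, hilbertTwo_eq, twoExponent, twoExponent]
    congr 2
    rw [mul_comm (primeFreePart 2 a - 1)]
    ring
  · intro a a' b ha ha' hb
    simp only [hilbertTwo_eq]
    rw [← Units.val_mul, ← Int.negOnePow_add, padicValInt.mul ha ha', primeFreePart_mul ha ha']
    congr 1
    rw [Int.negOnePow_eq_iff]
    have hu := odd_primeFreePart_two ha
    have hu' := odd_primeFreePart_two ha'
    have hw := odd_primeFreePart_two hb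
    generalize primeFreePart 2 a = u at *
    generalize primeFreePart 2 a' = u' at *
    generalize primeFreePart 2 b = w at *
    generalize padicValInt 2 a = α
    generalize padicValInt 2 a' = α'
    generalize padicValInt 2 b = β
    have h1 := four_mul_div_of_odd hu hw
    have h2 := four_mul_div_of_odd hu' hw
    have h3 := four_mul_div_of_odd (hu.mul hu') hw
    have h4 := eight_mul_div_of_odd hu
    have h5 := eight_mul_div_of_odd hu'
    have h6 := eight_mul_div_of_odd (hu.mul hu')
    unfold twoExponent
    generalize (u - 1) * (w - 1) / 4 = e1 at *
    generalize (u' - 1) * (w - 1) / 4 = e2 at *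
    generalize (u * u' - 1) * (w - 1) / 4 = e3 at *
    generalize (u ^ 2 - 1) / 8 = f1 at *
    generalize (u' ^ 2 - 1) / 8 = f2 at *
    generalize ((u * u') ^ 2 - 1) / 8 = f3 at *
    generalize (w ^ 2 - 1) / 8 = f
    -- Modulo 2, `(u² - 1)/8` is additive in products of odd integers; `h9` is the analogue for `(u
    -- - 1)(w - 1)/4`.
    have h7 : f3 = 8 * (f1 * f2) + f1 + f2 := by
      have h8 : 8 * f3 = 8 * (8 * (f1 * f2) + f1 + f2) := by
        have hu2 : u ^ 2 = 8 * f1 + 1 := by linarith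
        have hu2' : u' ^ 2 = 8 * f2 + 1 := by linarith
        rw [h6, mul_pow, hu2, hu2']
        ring
      linarith
    obtain ⟨x, rfl⟩ := hu
    obtain ⟨x', rfl⟩ := hu'
    obtain ⟨y, rfl⟩ := hw
    have h9 : e3 = e1 + e2 + 2 * (x * x' * y) := by
      have : 4 * e3 = 4 * (e1 + e2 + 2 * (x * x' * y)) := by linear_combination h3 - h1 - h2
      linarith
    rw [h7, h9]
    push_cast
    exact ⟨x * x' * y + 4 * β * f1 * f2, by ring⟩
  · intro a ha
    rw [hilbertTwo_eq, ← Units.val_one, Units.val_inj, Int.negOnePow_eq_one_iff,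
      padicValInt_neg, primeFreePart_neg]
    have hu := odd_primeFreePart_two ha
    generalize primeFreePart 2 a = u at *
    generalize padicValInt 2 a = α
    have h1 := four_mul_div_of_odd hu hu.neg
    have h2 := eight_mul_div_of_odd hu
    unfold twoExponent
    rw [neg_sq]
    generalize (u - 1) * (-u - 1) / 4 = e1 at *
    generalize (u ^ 2 - 1) / 8 = f1 at *
    have h3 : e1 = -2 * f1 := by linarith
    exact ⟨-f1 + α * f1, by rw [h3]; ring⟩
  · intro a b c ha hb hc habc
    have hc1 := not_dvd_primeFreePart (p := 2) hc
    have hc2 := pow_mul_primeFreePart (p := 2) c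
    set γ := padicValInt 2 c
    set d := primeFreePart 2 c
    have ha' := odd_of_not_two_dvd ha
    have hb' := odd_of_not_two_dvd hb
    have hd' := odd_of_not_two_dvd hc1
    have o1 : Odd (-(a * d)) := (ha'.mul hd').neg
    have o2 : Odd (-(b * d)) := (hb'.mul hd').neg
    have n1 : ¬ ((2 : ℕ) : ℤ) ∣ -(a * d) := by
      have := Int.not_even_iff_odd.2 o1
      rw [even_iff_two_dvd] at this
      exact_mod_cast this
    have n2 : ¬ ((2 : ℕ) : ℤ) ∣ -(b * d) := by
      have := Int.not_even_iff_odd.2 o2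
      rw [even_iff_two_dvd] at this
      exact_mod_cast this
    have e1 : -(a * c) = ((2 : ℕ) : ℤ) ^ γ * -(a * d) := by rw [← hc2]; ring
    have e2 : -(b * c) = ((2 : ℕ) : ℤ) ^ γ * -(b * d) := by rw [← hc2]; ring
    rw [hilbertTwo_eq, ← Units.val_one, Units.val_inj, Int.negOnePow_eq_one_iff]
    rw [e1, e2, padicValInt_pow_mul n1, padicValInt_pow_mul n2, primeFreePart_pow_mul n1,
      primeFreePart_pow_mul n2]
    have h1 := four_mul_div_of_odd o1 o2
    have h2 := eight_mul_div_of_odd o1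
    have h3 := eight_mul_div_of_odd o2
    unfold twoExponent
    generalize (-(a * d) - 1) * (-(b * d) - 1) / 4 = e at *
    generalize ((-(a * d)) ^ 2 - 1) / 8 = f at *
    generalize ((-(b * d)) ^ 2 - 1) / 8 = g at *
    obtain ⟨z, hz⟩ := hd'
    obtain ⟨x, hx⟩ := ha'
    push_cast at hc2
    have hbe : b = -a - c := by linarith
    have hγ : γ ≠ 0 := by
      intro h0
      rw [h0, pow_zero, one_mul] at hc2
      obtain ⟨y, hy⟩ := hb'
      omega
    by_cases hγ1 : γ = 1
    · rw [hγ1, pow_one] at hc2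
      rw [hγ1]
      -- The left side equals `2s(s + 2)` with `s = (a + b)d = -2d²`, and `d² - 1 = 4z(z + 1)`.
      have : 16 * (e + f + g) = 16 * (2 * (z * (z + 1) * (d ^ 2) )) := by
        rw [hbe, ← hc2] at h1 h3
        have hz2 : 4 * (z * (z + 1)) = d ^ 2 - 1 := by rw [hz]; ring
        linear_combination 4 * h1 + 2 * h2 + 2 * h3 - 8 * d ^ 2 * hz2
      refine ⟨z * (z + 1) * d ^ 2, ?_⟩
      push_cast
      linarith
    · obtain ⟨δ, hδ⟩ : ∃ δ, γ = δ + 2 := ⟨γ - 2, by omega⟩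
      rw [hδ, pow_add] at hc2
      rw [hbe, ← hc2] at h1 h3
      -- Since `4 ∣ c`, `b ≡ -a` modulo 4, whence `4e ≡ 1 - (ad)² ≡ 0` modulo 8.
      have he : Even e := by
        obtain ⟨r, hr⟩ : ∃ r, a * d = 2 * r + 1 := by
          obtain ⟨r, hr⟩ := o1
          exact ⟨-r - 1, by linarith⟩
        obtain ⟨s, hs⟩ := Int.even_mul_succ_self r
        refine ⟨-s - (r + 1) * 2 ^ δ * d ^ 2, ?_⟩
        have : 4 * e = 4 * (-s - (r + 1) * 2 ^ δ * d ^ 2 + (-s - (r + 1) * 2 ^ δ * d ^ 2)) := by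
          linear_combination h1 - 4 * hs - (a * d + 2 * r + 1 + 4 * 2 ^ δ * d ^ 2) * hr
        linarith
      rw [add_assoc, ← mul_add]
      refine he.add ?_
      rcases Nat.even_or_odd γ with hev | hodd
      · exact ((Int.even_coe_nat γ).2 hev).mul_right _
      -- An odd `γ ≥ 2` is at least 3, so `8 ∣ c`, `b² ≡ a²` modulo 16, and `f`, `g` have the same
      -- parity.
      · obtain ⟨ε, rfl⟩ : ∃ ε, δ = ε + 1 := by
          refine ⟨δ - 1, ?_⟩
          obtain ⟨m, hm⟩ := hodd
          omega
        refine Even.mul_left ?_ _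
        refine ⟨f + (2 ^ ε * a * d ^ 3 + 4 * (2 ^ ε) ^ 2 * d ^ 4), ?_⟩
        have : 8 * (g + f) = 8 * (f + (2 ^ ε * a * d ^ 3 + 4 * (2 ^ ε) ^ 2 * d ^ 4) +
            (f + (2 ^ ε * a * d ^ 3 + 4 * (2 ^ ε) ^ 2 * d ^ 4))) := by
          linear_combination h3 - h2
        linarith

end Two

theorem hilbertSymbol_isIntSymbol (p : RatPlace) : IsIntSymbol (hilbertSymbol p) := by
  cases p with
  | infinity => exact hilbertInfinity_isIntSymbol
  | prime p =>
    have : Fact (p : ℕ).Prime := ⟨p.2⟩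
    by_cases h : (p : ℕ) = 2
    · have e : hilbertSymbol (.prime p) = hilbertTwo := by
        funext a b; simp [hilbertSymbol, h]
      rw [e]
      exact hilbertTwo_isIntSymbol
    · have e : hilbertSymbol (.prime p) = hilbertOdd p := by
        funext a b; simp [hilbertSymbol, h]
      rw [e]
      exact hilbertOdd_isIntSymbol

/-! ### Symbols of rationals and binary forms. -/

/-- A Steinberg symbol with values `±1` on the non-zero rationals. -/
structure IsRatSymbol (h : ℚ → ℚ → ℤ) : Prop where
  mul_self : ∀ {x y : ℚ}, x ≠ 0 → y ≠ 0 → h x y * h x y = 1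
  symm : ∀ x y : ℚ, h x y = h y x
  mul_left : ∀ {x x' y : ℚ}, x ≠ 0 → x' ≠ 0 → y ≠ 0 → h (x * x') y = h x y * h x' y
  neg_self : ∀ {x : ℚ}, x ≠ 0 → h x (-x) = 1
  steinberg : ∀ {x y : ℚ}, x ≠ 0 → y ≠ 0 → x + y = 1 → h x y = 1

theorem IsIntSymbol.congr_left {h : ℤ → ℤ → ℤ} (H : IsIntSymbol h) {a b s t y : ℤ} (ha : a ≠ 0)
    (hb : b ≠ 0) (hs : s ≠ 0) (ht : t ≠ 0) (hy : y ≠ 0) (e : a * s ^ 2 = b * t ^ 2) :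
    h a y = h b y := by
  have e1 : h (a * (s * s)) y = h (b * (t * t)) y := by rw [← sq, ← sq, e]
  rwa [H.mul_left ha (mul_ne_zero hs hs) hy, H.mul_left hb (mul_ne_zero ht ht) hy,
    H.mul_left hs hs hy, H.mul_left ht ht hy, H.mul_self hs hy, H.mul_self ht hy, mul_one,
    mul_one] at e1

/-- A rational `x` and the integer `x.num * x.den` differ by the square of `x.den`, so the rules
carry over from integers. Clearing denominators turns `x + y = 1` into a zero-sum triple with third
member `-(x.den * y.den)`. -/
theorem hilbertSymbolRat_isRatSymbol (p : RatPlace) : IsRatSymbol (hilbertSymbolRat p) := by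
  have H := hilbertSymbol_isIntSymbol p
  have hd : ∀ x : ℚ, (x.den : ℤ) ≠ 0 := fun x => by exact_mod_cast x.den_ne_zero
  have hn : ∀ {x : ℚ}, x ≠ 0 → x.num * (x.den : ℤ) ≠ 0 := fun {x} hx =>
    mul_ne_zero (Rat.num_ne_zero.2 hx) (hd x)
  have cast : ∀ x : ℚ, (x.num : ℚ) = x * x.den := fun x => (Rat.mul_den_eq_num x).symm
  refine ⟨fun hx hy => H.mul_self (hn hx) (hn hy), fun x y => H.symm _ _, ?_, ?_, ?_⟩
  · intro x x' y hx hx' hy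
    unfold hilbertSymbolRat
    rw [← H.mul_left (hn hx) (hn hx') (hn hy)]
    refine H.congr_left (s := x.den * x'.den) (t := (x * x').den) (hn (mul_ne_zero hx hx'))
      (mul_ne_zero (hn hx) (hn hx')) (mul_ne_zero (hd _) (hd _)) (hd _) (hn hy) ?_
    rw [← Int.cast_inj (α := ℚ)]
    push_cast
    rw [cast, cast x, cast x']
    ring
  · intro x hx
    unfold hilbertSymbolRat
    rw [Rat.num_neg_eq_neg_num, Rat.den_neg_eq_den, neg_mul]
    exact H.neg_self (hn hx)
  · intro x y hx hy hxy
    have h1 : x.num * y.den + y.num * x.den + -(x.den * y.den : ℤ) = 0 := by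
      rw [← Int.cast_inj (α := ℚ)]
      push_cast
      rw [cast x, cast y]
      linear_combination (x.den * y.den : ℚ) * hxy
    have nx := mul_ne_zero (Rat.num_ne_zero.2 hx) (hd y)
    have ny := mul_ne_zero (Rat.num_ne_zero.2 hy) (hd x)
    have nd := mul_ne_zero (hd x) (hd y)
    have h2 := H.steinberg nx ny (neg_ne_zero.2 nd) h1
    have n1 := neg_ne_zero.2 (mul_ne_zero nx (neg_ne_zero.2 nd))
    have n2 := neg_ne_zero.2 (mul_ne_zero ny (neg_ne_zero.2 nd))
    unfold hilbertSymbolRat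
    rw [← h2, H.congr_left (hn hx) n1 (hd y) one_ne_zero (hn hy) (by ring), H.symm,
      H.congr_left (hn hy) n2 (hd x) one_ne_zero n1 (by ring), H.symm]

theorem hilbertSymbolRat_intCast (p : RatPlace) (a b : ℤ) :
    hilbertSymbolRat p a b = hilbertSymbol p a b := by
  simp [hilbertSymbolRat]

namespace IsRatSymbol

variable {h : ℚ → ℚ → ℤ}

theorem mul_right (H : IsRatSymbol h) {x y z : ℚ} (hx : x ≠ 0) (hy : y ≠ 0) (hz : z ≠ 0) :
    h x (y * z) = h x y * h x z := by
  rw [H.symm, H.mul_left hy hz hx, H.symm y, H.symm z]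

theorem neg_right (H : IsRatSymbol h) {x y : ℚ} (hx : x ≠ 0) (hy : y ≠ 0) :
    h x (-y) = h x (-1) * h x y := by
  rw [neg_eq_neg_one_mul, H.mul_right hx (by norm_num) hy]

theorem neg_left (H : IsRatSymbol h) {x y : ℚ} (hx : x ≠ 0) (hy : y ≠ 0) :
    h (-x) y = h (-1) y * h x y := by
  rw [neg_eq_neg_one_mul, H.mul_left (by norm_num) hx hy]

theorem self (H : IsRatSymbol h) {x : ℚ} (hx : x ≠ 0) : h x x = h (-1) x := by
  have h1 := H.neg_self hx
  rw [H.neg_right hx hx, H.symm x (-1)] at h1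
  have h2 := H.mul_self (x := -1) (by norm_num) hx
  linear_combination h (-1) x * h1 - h x x * h2

theorem one_left (H : IsRatSymbol h) {x : ℚ} (hx : x ≠ 0) : h 1 x = 1 := by
  have h1 := H.mul_left one_ne_zero one_ne_zero hx
  rwa [one_mul, H.mul_self one_ne_zero hx] at h1

theorem mul_sq_left (H : IsRatSymbol h) {x y s : ℚ} (hx : x ≠ 0) (hy : y ≠ 0) (hs : s ≠ 0) :
    h (x * s ^ 2) y = h x y := by
  rw [sq, H.mul_left hx (mul_ne_zero hs hs) hy, H.mul_left hs hs hy, H.mul_self hs hy, mul_one]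

/-- The binary forms `⟨d, m⟩` and `⟨x, d m x⟩` have the same invariant if the first one
represents `x`. -/
theorem binary (H : IsRatSymbol h) {d m x u : ℚ} (hd : d ≠ 0) (hm : m ≠ 0) (hx : x ≠ 0)
    (e : x = d + u ^ 2 * m) : h d m = h x (-(d * m)) := by
  -- The relation `d/x + u²m/x = 1` is a Steinberg relation only if its second term is non-zero.
  by_cases hu : u = 0
  · have : x = d := by simpa [hu] using e
    rw [this, H.neg_right hd (mul_ne_zero hd hm), H.mul_right hd hd hm, H.self hd, H.symm (-1) d]
    have := H.mul_self hd (y := -1) (by norm_num)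
    linear_combination -h d m * this
  · have h1 : h (d * x) (m * x) = 1 := by
      have h2 := H.steinberg (x := d / x) (y := u ^ 2 * m / x) (div_ne_zero hd hx)
        (div_ne_zero (mul_ne_zero (pow_ne_zero _ hu) hm) hx)
        (by rw [← add_div, ← e, div_self hx])
      have e1 : d * x = d / x * x ^ 2 := by field_simp
      have e2 : u ^ 2 * m / x = m * x * (u / x) ^ 2 := by field_simp
      have n2 := mul_ne_zero hm hx
      rw [e1, H.mul_sq_left (div_ne_zero hd hx) n2 hx]
      rwa [e2, H.symm, H.mul_sq_left n2 (div_ne_zero hd hx) (div_ne_zero hu hx), H.symm] at h2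
    rw [H.mul_left hd hx (mul_ne_zero hm hx), H.mul_right hd hm hx, H.mul_right hx hm hx,
      H.self hx, H.symm (-1)] at h1
    rw [H.neg_right hx (mul_ne_zero hd hm), H.mul_right hx hd hm, H.symm x d]
    have a1 := H.mul_self hd hx
    have a2 := H.mul_self hx hm
    have a3 := H.mul_self hx (y := -1) (by norm_num)
    generalize h d m = b0 at *
    generalize h d x = b1 at *
    generalize h x m = b2 at *
    generalize h x (-1) = b3 at *
    grind

theorem pow_two (H : IsRatSymbol h) {x y : ℚ} (hx : x ≠ 0) (hy : y ≠ 0) : h x y ^ 2 = 1 := by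
  rw [sq, H.mul_self hx hy]

theorem pow_four (H : IsRatSymbol h) {x y : ℚ} (hx : x ≠ 0) (hy : y ≠ 0) : h x y ^ 4 = 1 := by
  rw [show 4 = 2 * 2 from rfl, pow_mul, H.pow_two hx hy, one_pow]

/-- The induction step of `hasseSeq_rank_one`: the diagonal entries `lDX`, `d` are exchanged for `x`
and `l(Dd)(Xx)`. By hypothesis `e` the two binary forms have equal invariants; after full expansion
all other symbols cancel in pairs. -/
theorem rank_one_step (H : IsRatSymbol h) {x d X D l : ℚ} (hd : d ≠ 0) (hl : l ≠ 0) (hx : x ≠ 0)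
    (hX : X ≠ 0) (hD : D ≠ 0) (e : h d (l * D * X) = h x (-(d * (l * D * X)))) :
    h (-X) x * h (-(X * x)) (l * (D * d) * (X * x)) * h (-X) (l * D * X) =
      h (-D) d * h (-(D * d)) l * h (-D) l := by
  have n1 : (-1 : ℚ) ≠ 0 := by norm_num
  have e2 : h d (l * D * X) * h x (-(d * (l * D * X))) = 1 := by
    rw [← e]; exact H.mul_self hd (mul_ne_zero (mul_ne_zero hl hD) hX)
  have e3 : (h (-X) x * h (-(X * x)) (l * (D * d) * (X * x)) * h (-X) (l * D * X)) *
      (h (-D) d * h (-(D * d)) l * h (-D) l) * (h d (l * D * X) * h x (-(d * (l * D * X)))) = 1 := by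
    simp only [H.neg_left, H.neg_right, H.mul_left, H.mul_right, H.self, n1, hd, hl, hx, hX, hD,
      Ne, mul_eq_zero, not_false_eq_true, or_self]
    simp only [H.symm]
    ring_nf
    simp only [H.pow_two, H.pow_four, n1, hd, hl, hx, hX, hD,
      Ne, not_false_eq_true, mul_one]
  have e4 : (h (-D) d * h (-(D * d)) l * h (-D) l) * (h (-D) d * h (-(D * d)) l * h (-D) l) = 1 := by
    have a1 := H.mul_self (neg_ne_zero.2 hD) hd
    have a2 := H.mul_self (neg_ne_zero.2 (mul_ne_zero hD hd)) hl
    have a3 := H.mul_self (neg_ne_zero.2 hD) hl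
    calc _ = (h (-D) d * h (-D) d) * (h (-(D * d)) l * h (-(D * d)) l) *
          (h (-D) l * h (-D) l) := by ring
      _ = 1 := by rw [a1, a2, a3]; rfl
  rw [e2, mul_one] at e3
  calc _ = _ * ((h (-D) d * h (-(D * d)) l * h (-D) l) *
        (h (-D) d * h (-(D * d)) l * h (-D) l)) := by rw [e4, mul_one]
    _ = _ := by rw [← mul_assoc, e3, one_mul]

/-! ### The invariant as a function of the leading minors. -/

/-- The Hasse-Minkowski invariant of a form with leading minors `P 0 = 1, P 1, …, P n`. -/
def hasseSeq (h : ℚ → ℚ → ℤ) (P : ℕ → ℚ) (n : ℕ) : ℤ :=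
  h (-1) (-1) * ∏ i ∈ Finset.range n, h (-P i) (P i * P (i + 1))

theorem hasseSeq_succ (P : ℕ → ℚ) (n : ℕ) :
    hasseSeq h P (n + 1) = hasseSeq h P n * h (-P n) (P n * P (n + 1)) := by
  rw [hasseSeq, Finset.prod_range_succ, ← mul_assoc]
  rfl

theorem hasseSeq_congr {P Q : ℕ → ℚ} {n : ℕ} (e : ∀ i ≤ n, P i = Q i) :
    hasseSeq h P n = hasseSeq h Q n := by
  unfold hasseSeq
  congr 1
  refine Finset.prod_congr rfl fun i hi => ?_
  rw [Finset.mem_range] at hi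
  rw [e i hi.le, e (i + 1) hi]

/-- Up to a square, `P i * P (i + 1)` is the diagonal entry `P (i + 1) / P i`. In the form
`hasseSeq`, adjoining a variable therefore multiplies the invariant by one symbol of the old
determinant and the new entry. -/
theorem eq_hasseSeq (H : IsRatSymbol h) {P : ℕ → ℚ} (h0 : P 0 = 1) {m : ℕ}
    (hP : ∀ i ≤ m + 1, P i ≠ 0) :
    h (-1) (-P (m + 1)) * ∏ i ∈ Finset.range m, h (P (i + 1)) (-P (i + 2)) =
      hasseSeq h P (m + 1) := by
  have n1 : (-1 : ℚ) ≠ 0 := by norm_num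
  induction m with
  | zero => simp [hasseSeq, h0, H.neg_right n1 (hP 1 le_rfl)]
  | succ m ih =>
    have a1 := hP (m + 1) (by omega)
    have a2 := hP (m + 2) le_rfl
    rw [hasseSeq_succ, ← ih fun i hi => hP i (by omega), Finset.prod_range_succ]
    simp only [H.neg_left, H.neg_right, H.mul_right, H.self, n1, a1, a2, Ne, mul_eq_zero,
      not_false_eq_true, or_self]
    rw [H.symm (P (m + 1)) (-1)]
    have b1 := H.mul_self n1 n1
    have b2 := H.mul_self n1 a1
    generalize ∏ i ∈ Finset.range m, h (P (i + 1)) (-P (i + 2)) = Z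
    generalize h (-1) (-1) = y1 at *
    generalize h (-1) (P (m + 1)) = y2 at *
    generalize h (-1) (P (m + 1 + 1)) = y3 at *
    generalize h (P (m + 1)) (P (m + 1 + 1)) = y4 at *
    linear_combination (-(y1 * y2 * y3 * Z * y4) * b2)

/-- Both sides are the invariant of the form `D ⊥ ⟨l⟩`: on the right its minors end in `D n, l * D
n`, on the left in `X n, l * D n`. -/
theorem hasseSeq_rank_one (H : IsRatSymbol h) {D X : ℕ → ℚ} {l : ℚ} (hl : l ≠ 0) (hD0 : D 0 = 1)
    (hX0 : X 0 = 1) {n : ℕ} (hD : ∀ i ≤ n, D i ≠ 0) (hX : ∀ i ≤ n, X i ≠ 0)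
    (hXD : ∀ i < n, ∃ w, X (i + 1) * D i = X i * D (i + 1) + l * w ^ 2) :
    hasseSeq h X n * h (-X n) (l * D n * X n) = hasseSeq h D n * h (-D n) l := by
  induction n with
  | zero => simp [hasseSeq, hD0, hX0]
  | succ n ih =>
    have ih := ih (fun i hi => hD i (by omega)) (fun i hi => hX i (by omega))
      fun i hi => hXD i (by omega)
    obtain ⟨w, hw⟩ := hXD n (by omega)
    have d0 := hD n (by omega)
    have x0 := hX n (by omega)
    obtain ⟨d, hd⟩ : ∃ d, D (n + 1) = D n * d := ⟨D (n + 1) / D n, by field_simp⟩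
    obtain ⟨x, hx⟩ : ∃ x, X (n + 1) = X n * x := ⟨X (n + 1) / X n, by field_simp⟩
    have d1 : d ≠ 0 := by rintro rfl; exact hD (n + 1) le_rfl (by rw [hd, mul_zero])
    have x1 : x ≠ 0 := by rintro rfl; exact hX (n + 1) le_rfl (by rw [hx, mul_zero])
    rw [hasseSeq_succ, hasseSeq_succ, hd, hx]
    have e1 : D n * (D n * d) = d * D n ^ 2 := by ring
    have e2 : X n * (X n * x) = x * X n ^ 2 := by ring
    rw [e1, e2, H.symm (-D n) (d * _), H.symm (-X n) (x * _),
      H.mul_sq_left d1 (neg_ne_zero.2 d0) d0, H.mul_sq_left x1 (neg_ne_zero.2 x0) x0,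
      H.symm d (-D n), H.symm x (-X n)]
    -- Divided by `D n * X n`, the relation `hw` says that `⟨d, l * D n * X n⟩` represents `x`.
    have e3 : x = d + (w / (D n * X n)) ^ 2 * (l * D n * X n) := by
      rw [hd, hx] at hw
      field_simp
      linear_combination hw
    have key := H.rank_one_step d1 hl x1 x0 d0
      (H.binary d1 (mul_ne_zero (mul_ne_zero hl d0) x0) x1 e3)
    have c1 := H.mul_self (neg_ne_zero.2 x0) (mul_ne_zero (mul_ne_zero hl d0) x0)
    have c2 := H.mul_self (neg_ne_zero.2 d0) hl
    generalize h (-X n) (l * D n * X n) = s1 at *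
    generalize h (-D n) l = s2 at *
    generalize h (-(X n * x)) (l * (D n * d) * (X n * x)) = s3 at *
    generalize h (-(D n * d)) l = s4 at *
    generalize h (-X n) x = s5 at *
    generalize h (-D n) d = s6 at *
    linear_combination s1 * hasseSeq h X n * key - s3 * s5 * hasseSeq h X n * c1 +
      s6 * s4 * s2 * ih + hasseSeq h D n * s6 * s4 * c2

/-- The factor at `n + i` is that of `Q` at `i` times `h (P n) (Q i * Q (i + 1))`, and these extra
symbols telescope to `h (P n) (Q m)`. The factor `h (-1) (-1)` removes one of the two leading
constants. -/
theorem hasseSeq_add (H : IsRatSymbol h) {P Q : ℕ → ℚ} {n m : ℕ} (hQ0 : Q 0 = 1) (hP : P n ≠ 0)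
    (hQ : ∀ i ≤ m, Q i ≠ 0) (e : ∀ i ≤ m, P (n + i) = P n * Q i) :
    hasseSeq h P (n + m) = hasseSeq h P n * hasseSeq h Q m * (h (-1) (-1) * h (P n) (Q m)) := by
  have n1 : (-1 : ℚ) ≠ 0 := by norm_num
  induction m with
  | zero => simp [hasseSeq, hQ0, H.symm _ 1, H.one_left hP, mul_assoc, H.mul_self n1 n1]
  | succ m ih =>
    have a1 := hQ m (by omega)
    have a2 := hQ (m + 1) le_rfl
    rw [← add_assoc, hasseSeq_succ, hasseSeq_succ, ih (fun i hi => hQ i (by omega))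
      fun i hi => e i (by omega), add_assoc n m 1, e m (by omega), e (m + 1) le_rfl]
    have e1 : P n * Q m * (P n * Q (m + 1)) = (Q m * Q (m + 1)) * P n ^ 2 := by ring
    rw [e1, H.symm (-(P n * Q m)), H.mul_sq_left (mul_ne_zero a1 a2)
      (neg_ne_zero.2 (mul_ne_zero hP a1)) hP, ← mul_neg, H.mul_right (mul_ne_zero a1 a2) hP
      (neg_ne_zero.2 a1), H.symm (Q m * Q (m + 1)), H.symm (Q m * Q (m + 1)),
      H.mul_right hP a1 a2]
    have b := H.mul_self hP a1
    generalize h (P n) (Q m) = s1 at *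
    generalize h (P n) (Q (m + 1)) = s2 at *
    generalize h (-Q m) (Q m * Q (m + 1)) = s3 at *
    linear_combination (hasseSeq h P n * hasseSeq h Q m * h (-1) (-1) * s2 * s3) * b

end IsRatSymbol

/-! ### Leading minors under a constant translation. -/

/-- The determinant of the first `n` rows and columns of an infinite matrix. -/
def natMinor (M : ℕ → ℕ → ℚ) (n : ℕ) : ℚ :=
  (Matrix.of fun a b : Fin n => M a b).det

theorem natMinor_zero (M : ℕ → ℕ → ℚ) : natMinor M 0 = 1 := Matrix.det_fin_zero

theorem natMinor_congr {M N : ℕ → ℕ → ℚ} {n : ℕ} (e : ∀ a < n, ∀ b < n, M a b = N a b) :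
    natMinor M n = natMinor N n := by
  unfold natMinor
  congr 1
  ext a b
  exact e a a.2 b b.2

theorem natMinor_add {M : ℕ → ℕ → ℚ} {n m : ℕ}
    (e : ∀ a < n, ∀ b < m, M a (n + b) = 0) :
    natMinor M (n + m) = natMinor M n * natMinor (fun a b => M (n + a) (n + b)) m := by
  unfold natMinor
  rw [← Matrix.det_submatrix_equiv_self finSumFinEquiv, ← Matrix.det_fromBlocks_zero₁₂ _
    (Matrix.of fun (a : Fin m) (b : Fin n) => M (n + a) b)]
  congr 1
  ext a b
  rcases a with a | a <;> rcases b with b | b <;> simp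
  exact e a a.2 b b.2

theorem exists_solution_of_natMinor_ne_zero {M : ℕ → ℕ → ℚ} {n : ℕ} (hM : natMinor M n ≠ 0)
    (b : ℕ → ℚ) : ∃ y : ℕ → ℚ, ∀ a < n, ∑ j ∈ Finset.range n, M a j * y j = b a := by
  set A : Matrix (Fin n) (Fin n) ℚ := Matrix.of fun a b : Fin n => M a b with hA
  let z : Fin n → ℚ := A⁻¹.mulVec fun i => b i
  refine ⟨fun j => if hj : j < n then z ⟨j, hj⟩ else 0, fun a ha => ?_⟩
  have h1 : A.mulVec z = fun i : Fin n => b i := by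
    rw [Matrix.mulVec_mulVec, Matrix.mul_nonsing_inv _ (isUnit_iff_ne_zero.2 hM),
      Matrix.one_mulVec]
  have h2 := congrFun h1 ⟨a, ha⟩
  rw [Finset.sum_range]
  simpa [Matrix.mulVec, dotProduct, hA] using h2

/-- The matrix determinant lemma, with `y` in the role of `M⁻¹` applied to the all-ones vector. -/
theorem natMinor_add_const {M : ℕ → ℕ → ℚ} {n : ℕ} {y : ℕ → ℚ}
    (hy : ∀ a < n, ∑ j ∈ Finset.range n, M a j * y j = 1) (l : ℚ) :
    natMinor (fun a b => M a b + l) n =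
      natMinor M n * (1 + l * ∑ j ∈ Finset.range n, y j) := by
  have h1 : (Matrix.of fun a b : Fin n => M a b + l) =
      (Matrix.of fun a b : Fin n => M a b) *
        (1 + Matrix.replicateCol Unit (fun j : Fin n => y j) *
          Matrix.replicateRow Unit fun _ : Fin n => l) := by
    ext a b
    have := hy a a.2
    rw [Finset.sum_range] at this
    rw [Matrix.mul_add, Matrix.mul_one, ← Matrix.mul_assoc]
    simp [Matrix.mul_apply, this]
  unfold natMinor
  rw [h1, Matrix.det_mul, Matrix.det_one_add_replicateCol_mul_replicateRow]
  simp [dotProduct, Finset.sum_range, Finset.mul_sum]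

/-- The second factor is the Schur complement: the combination `z` of the first `n` columns clears
the last column above its corner. -/
theorem natMinor_succ {M : ℕ → ℕ → ℚ} {n : ℕ} {z : ℕ → ℚ}
    (hz : ∀ a < n, ∑ j ∈ Finset.range n, M a j * z j = M a n) :
    natMinor M (n + 1) =
      natMinor M n * (M n n - ∑ j ∈ Finset.range n, M n j * z j) := by
  have h1 : (Matrix.of fun a b : Fin (n + 1) => M a b).submatrix
      (finSumFinEquiv (m := n) (n := 1)) (finSumFinEquiv (m := n) (n := 1)) =
      Matrix.fromBlocks (Matrix.of fun a b : Fin n => M a b) 0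
        (Matrix.of fun (_ : Fin 1) (b : Fin n) => M n b)
        (Matrix.of fun (_ _ : Fin 1) => M n n - ∑ j ∈ Finset.range n, M n j * z j) *
      Matrix.fromBlocks 1 (Matrix.of fun (a : Fin n) (_ : Fin 1) => z a) 0 1 := by
    rw [Matrix.fromBlocks_multiply]
    ext a b
    rcases a with a | a <;> rcases b with b | b
    · simp
    · have := hz a a.2
      rw [Finset.sum_range] at this
      simp [Matrix.mul_apply, this]
    · simp
    · simp [Matrix.mul_apply, Finset.sum_range]
  unfold natMinor
  rw [← Matrix.det_submatrix_equiv_self (finSumFinEquiv (m := n) (n := 1)), h1, Matrix.det_mul,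
    Matrix.det_fromBlocks_zero₁₂, Matrix.det_fromBlocks_zero₂₁]
  simp

/-- Consecutive leading minors of a symmetric matrix and of its translate by the constant `l`. -/
theorem exists_sq_natMinor_add_const {M : ℕ → ℕ → ℚ} {n : ℕ}
    (hs : ∀ a ≤ n, ∀ b ≤ n, M a b = M b a) (h0 : natMinor M n ≠ 0)
    (h1 : natMinor M (n + 1) ≠ 0) (l : ℚ) :
    ∃ w, natMinor (fun a b => M a b + l) (n + 1) * natMinor M n =
      natMinor (fun a b => M a b + l) n * natMinor M (n + 1) + l * w ^ 2 := by
  obtain ⟨y, hy⟩ := exists_solution_of_natMinor_ne_zero h0 fun _ => 1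
  obtain ⟨z, hz⟩ := exists_solution_of_natMinor_ne_zero h0 fun a => M a n
  have hD := natMinor_succ hz
  -- By symmetry of `M`, both sides are the pairing of the all-ones vector with the last column
  -- under `M⁻¹`.
  have hzy : ∑ j ∈ Finset.range n, z j = ∑ j ∈ Finset.range n, M n j * y j := by
    calc ∑ j ∈ Finset.range n, z j
        = ∑ j ∈ Finset.range n, ∑ i ∈ Finset.range n, z j * (M j i * y i) := by
          refine Finset.sum_congr rfl fun j hj => ?_
          rw [← Finset.mul_sum, hy j (Finset.mem_range.1 hj), mul_one]
      _ = ∑ i ∈ Finset.range n, ∑ j ∈ Finset.range n, z j * (M j i * y i) := Finset.sum_comm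
      _ = _ := by
          refine Finset.sum_congr rfl fun i hi => ?_
          have hi' := (Finset.mem_range.1 hi)
          rw [hs n le_rfl i hi'.le, ← hz i hi', Finset.sum_mul]
          refine Finset.sum_congr rfl fun j hj => ?_
          rw [hs j (Finset.mem_range.1 hj).le i hi'.le]
          ring
  set d := M n n - ∑ j ∈ Finset.range n, M n j * z j with hd
  have d0 : d ≠ 0 := by
    intro h
    rw [h, mul_zero] at hD
    exact h1 hD
  set u := 1 - ∑ j ∈ Finset.range n, M n j * y j with hu
  -- The solution of the bordered system: `y` corrected along `(-z, 1)`, where `u` is the defect of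
  -- `y` in the new row and `d` the Schur complement.
  let y' : ℕ → ℚ := fun j => if j < n then y j - u / d * z j else u / d
  have hy'n : y' n = u / d := by simp [y']
  have hy'sum : ∀ f : ℕ → ℚ, ∑ j ∈ Finset.range n, f j * y' j =
      ∑ j ∈ Finset.range n, f j * y j - u / d * ∑ j ∈ Finset.range n, f j * z j := by
    intro f
    rw [Finset.mul_sum, ← Finset.sum_sub_distrib]
    refine Finset.sum_congr rfl fun j hj => ?_
    simp only [y', if_pos (Finset.mem_range.1 hj)]
    ring
  have hy' : ∀ a < n + 1, ∑ j ∈ Finset.range (n + 1), M a j * y' j = 1 := by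
    intro a ha
    rw [Finset.sum_range_succ, hy'sum, hy'n]
    rcases Nat.lt_succ_iff_lt_or_eq.1 ha with ha | rfl
    · rw [hy a ha, hz a ha]
      ring
    · have : M a a = d + ∑ j ∈ Finset.range a, M a j * z j := by rw [hd]; ring
      rw [this]
      have : ∑ j ∈ Finset.range a, M a j * y j = 1 - u := by rw [hu]; ring
      rw [this]
      field_simp
      ring
  -- The sum of `y'` exceeds that of `y` by `u² / d`, and the minors of `M` have ratio `d`.
  refine ⟨natMinor M n * u, ?_⟩
  rw [natMinor_add_const hy', natMinor_add_const hy, hD, Finset.sum_range_succ, hy'n]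
  have e1 := hy'sum fun _ => 1
  simp only [one_mul] at e1
  have e2 : ∑ j ∈ Finset.range n, M n j * y j = 1 - u := by rw [hu]; ring
  rw [e1, hzy, e2]
  field_simp
  ring

/-- A square matrix, continued by zeros to an infinite one. -/
def natExtend {n : ℕ} (X : Matrix (Fin n) (Fin n) ℚ) (a b : ℕ) : ℚ :=
  if h : a < n ∧ b < n then X ⟨a, h.1⟩ ⟨b, h.2⟩ else 0

theorem natExtend_val {n : ℕ} (X : Matrix (Fin n) (Fin n) ℚ) (a b : Fin n) :
    natExtend X a b = X a b := by
  simp [natExtend]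

theorem leadingMinor_eq_natMinor {n : ℕ} (X : Matrix (Fin n) (Fin n) ℚ) (i : ℕ) (hi : i ≤ n) :
    leadingMinor X i hi = natMinor (natExtend X) i := by
  unfold leadingMinor natMinor
  congr 1
  ext a b
  exact (natExtend_val X (Fin.castLE hi a) (Fin.castLE hi b)).symm

theorem natMinor_natExtend {n : ℕ} (X : Matrix (Fin n) (Fin n) ℚ) :
    natMinor (natExtend X) n = X.det := by
  unfold natMinor
  congr 1
  ext a b
  exact natExtend_val X a b

theorem hasseMinkowski_eq_hasseSeq (p : RatPlace) {n : ℕ} (hn : n ≠ 0)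
    {X : Matrix (Fin n) (Fin n) ℚ} (hX : ∀ i ≤ n, natMinor (natExtend X) i ≠ 0) :
    hasseMinkowski p X = IsRatSymbol.hasseSeq (hilbertSymbolRat p) (natMinor (natExtend X)) n := by
  obtain ⟨m, rfl⟩ := Nat.exists_eq_succ_of_ne_zero hn
  rw [← IsRatSymbol.eq_hasseSeq (hilbertSymbolRat_isRatSymbol p) (natMinor_zero _) hX,
    Finset.prod_range]
  simp only [hasseMinkowski, leadingMinor_eq_natMinor, ← natMinor_natExtend X]
  rfl

/-! ### Determinants of the cycle matrices up to squares. -/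

section CycleMatrix

variable (R : Type*) [CommRing R]

/-- The permutation matrix of the cyclic shift. -/
def shiftMatrix (n : ℕ) : Matrix (Fin n) (Fin n) R := (finRotate n).permMatrix R

variable {R}

theorem shiftMatrix_apply {n : ℕ} (i j : Fin n) :
    shiftMatrix R n i j =
      if i.val + 1 = j.val ∨ (j.val = 0 ∧ i.val + 1 = n) then 1 else 0 := by
  obtain _ | n := n
  · exact i.elim0
  have h1 : shiftMatrix R (n + 1) i j = if finRotate (n + 1) i = j then 1 else 0 := by
    simp [shiftMatrix, PEquiv.toMatrix_apply, Equiv.toPEquiv_apply, eq_comm]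
  rw [h1]
  congr 1
  rw [eq_iff_iff, Fin.ext_iff, coe_finRotate]
  have := i.2
  have := j.2
  split_ifs with h
  · rw [h, Fin.val_last]; omega
  · rw [Fin.ext_iff, Fin.val_last] at h; omega

theorem shiftMatrix_mul_transpose (n : ℕ) :
    shiftMatrix R n * (shiftMatrix R n).transpose = 1 := by
  rw [shiftMatrix, Matrix.transpose_permMatrix, ← Matrix.permMatrix_mul, inv_mul_cancel,
    Matrix.permMatrix_one]

/-- For `n = 2` the shift equals its transpose, which accounts for the entries 2 of `B_2(a)`. -/
theorem map_cycleMatrix {n : ℕ} (hn : 2 ≤ n) (a : ℤ) :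
    (cycleMatrix n a).map (Int.cast : ℤ → R) =
      (a : R) • (1 : Matrix (Fin n) (Fin n) R) + shiftMatrix R n +
        (shiftMatrix R n).transpose := by
  ext i j
  simp only [Matrix.map_apply, Matrix.add_apply, Matrix.smul_apply, Matrix.transpose_apply,
    shiftMatrix_apply, Matrix.one_apply, cycleMatrix, Matrix.of_apply, Fin.ext_iff]
  have := i.2
  have := j.2
  split_ifs <;> first | omega | (simp; done) | (push_cast; norm_num)

theorem det_smul_one_add_shiftMatrix {n : ℕ} (hn : 2 ≤ n) (x : R) :
    (x • (1 : Matrix (Fin n) (Fin n) R) + shiftMatrix R n).det = x ^ n - (-1) ^ n := by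
  obtain ⟨m, rfl⟩ : ∃ m, n = m + 2 := ⟨n - 2, by omega⟩
  have ent : ∀ i j : Fin (m + 2), (x • (1 : Matrix (Fin (m + 2)) (Fin (m + 2)) R) +
      shiftMatrix R (m + 2)) i j = (if i.val = j.val then x else 0) +
        if i.val + 1 = j.val ∨ (j.val = 0 ∧ i.val + 1 = m + 2) then 1 else 0 := by
    intro i j
    rw [Matrix.add_apply, Matrix.smul_apply, shiftMatrix_apply, Matrix.one_apply]
    simp only [smul_eq_mul, mul_ite, mul_one, mul_zero, Fin.ext_iff]
  generalize x • (1 : Matrix (Fin (m + 2)) (Fin (m + 2)) R) + shiftMatrix R (m + 2) = A at ent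
  -- The first column has only `x` at the top and `1` at the bottom; both complementary minors are
  -- triangular.
  rw [Matrix.det_succ_column_zero, Fin.sum_univ_succ, Fin.sum_univ_castSucc,
    Finset.sum_eq_zero]
  · have d1 : (A.submatrix (Fin.succAbove 0) Fin.succ).det = x ^ (m + 1) := by
      rw [Matrix.det_of_isUpperTriangular]
      · simp [ent]
      · intro i j hij
        have hij' : j.val < i.val := hij
        rw [Matrix.submatrix_apply, ent, Fin.zero_succAbove, Fin.val_succ, Fin.val_succ,
          if_neg (by omega), if_neg (by omega), add_zero]
    have d2 : (A.submatrix (Fin.succAbove (Fin.last m).succ) Fin.succ).det = 1 := by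
      rw [Fin.succ_last, Matrix.det_of_isLowerTriangular]
      · simp [ent]
      · intro i j hij
        have hij' : i.val < j.val := hij
        rw [Matrix.submatrix_apply, ent, Fin.succAbove_last, Fin.val_succ, Fin.val_castSucc,
          if_neg (by omega), if_neg (by omega), add_zero]
    rw [d1, d2, ent, ent]
    simp
    ring
  · intro i _
    have := i.2
    rw [ent, if_neg (by simp), if_neg (by simp; omega)]
    simp

/-- With `S` the shift matrix and `a = x + 1/x`, `x B_n(a) = (xI + S)(xI + S)ᵀ` because `S Sᵀ = 1`.
-/
theorem pow_mul_det_cycleMatrix {n : ℕ} (hn : 2 ≤ n) {a : ℤ} {x : R} (hx : x * a = x ^ 2 + 1) :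
    x ^ n * ((cycleMatrix n a).det : R) = (x ^ n - (-1) ^ n) ^ 2 := by
  have h1 : x • (cycleMatrix n a).map (Int.cast : ℤ → R) =
      (x • (1 : Matrix (Fin n) (Fin n) R) + shiftMatrix R n) *
        (x • (1 : Matrix (Fin n) (Fin n) R) + shiftMatrix R n).transpose := by
    rw [map_cycleMatrix hn, Matrix.transpose_add, Matrix.transpose_smul, Matrix.transpose_one,
      Matrix.add_mul, Matrix.mul_add, Matrix.mul_add, shiftMatrix_mul_transpose]
    simp only [Matrix.smul_mul, Matrix.mul_smul, Matrix.one_mul, Matrix.mul_one, smul_add,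
      smul_smul, hx]
    module
  have h2 := congrArg Matrix.det h1
  rw [Matrix.det_smul, Matrix.det_mul, Matrix.det_transpose, det_smul_one_add_shiftMatrix hn,
    Fintype.card_fin] at h2
  rw [Int.cast_det, sq]
  exact h2

/-- The integer is `(x^m - x^(-m)) / (x - x⁻¹)`, which obeys `q_{m+2} = a q_{m+1} - q_m`; hence two
consecutive indices in the induction. -/
theorem exists_pow_even_sub_one {a : ℤ} {x : R} (hx : x * a = x ^ 2 + 1) (m : ℕ) :
    (∃ q : ℤ, (x ^ (2 * m) - 1) * x = (x ^ 2 - 1) * x ^ m * q) ∧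
      ∃ q : ℤ, (x ^ (2 * (m + 1)) - 1) * x = (x ^ 2 - 1) * x ^ (m + 1) * q := by
  induction m with
  | zero => exact ⟨⟨0, by simp⟩, ⟨1, by simp⟩⟩
  | succ m ih =>
    obtain ⟨⟨q, hq⟩, ⟨r, hr⟩⟩ := ih
    refine ⟨⟨r, hr⟩, ⟨a * r - q, ?_⟩⟩
    push_cast
    linear_combination (-(x ^ 2 - 1) * x ^ (m + 1) * r) * hx + (x ^ 2 + 1) * hr - x ^ 2 * hq

/-- The same recurrence as in `exists_pow_even_sub_one`, with initial values `1` and `a - 1`. -/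
theorem exists_pow_odd_add_one {a : ℤ} {x : R} (hx : x * a = x ^ 2 + 1) (m : ℕ) :
    (∃ q : ℤ, x ^ (2 * m + 1) + 1 = (x + 1) * x ^ m * q) ∧
      ∃ q : ℤ, x ^ (2 * (m + 1) + 1) + 1 = (x + 1) * x ^ (m + 1) * q := by
  induction m with
  | zero =>
    refine ⟨⟨1, by simp⟩, ⟨a - 1, ?_⟩⟩
    push_cast
    linear_combination (-(x + 1)) * hx
  | succ m ih =>
    obtain ⟨⟨q, hq⟩, ⟨r, hr⟩⟩ := ih
    refine ⟨⟨r, hr⟩, ⟨a * r - q, ?_⟩⟩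
    push_cast
    linear_combination (-(x + 1) * x ^ (m + 1) * r) * hx + (x ^ 2 + 1) * hr - x ^ 2 * hq

end CycleMatrix

/-- The square class of `cycleMatrix n a`. -/
def cycleClass (n : ℕ) (a : ℤ) : ℤ := if Even n then a ^ 2 - 4 else a + 2

theorem exists_det_cycleMatrix {n : ℕ} (hn : 2 ≤ n) {a : ℤ} (ha : 2 < a) :
    ∃ q : ℤ, (cycleMatrix n a).det = cycleClass n a * q ^ 2 := by
  have ha' : (2 : ℝ) < a := by exact_mod_cast ha
  -- A root of `x² - ax + 1`, real because `a > 2`. It gives `(x² - 1)² = x²(a² - 4)` and `(x + 1)²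
  -- = x(a + 2)`, the two square classes.
  obtain ⟨x, hx0, hx⟩ : ∃ x : ℝ, 0 < x ∧ x * a = x ^ 2 + 1 := by
    refine ⟨(a + √((a : ℝ) ^ 2 - 4)) / 2, by positivity, ?_⟩
    have := Real.sq_sqrt (show (0 : ℝ) ≤ (a : ℝ) ^ 2 - 4 by nlinarith)
    linear_combination -this / 4
  have key := pow_mul_det_cycleMatrix hn hx
  rcases Nat.even_or_odd n with he | ho
  · obtain ⟨m, rfl⟩ := he
    obtain ⟨q, hq⟩ := (exists_pow_even_sub_one hx m).1
    refine ⟨q, ?_⟩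
    rw [cycleClass, if_pos ⟨m, rfl⟩, ← Int.cast_inj (α := ℝ)]
    rw [← two_mul] at *
    rw [(even_two_mul m).neg_one_pow] at key
    push_cast [-Int.cast_det]
    have h1 : x ^ (2 * m) * x ^ 2 ≠ 0 := by positivity
    apply mul_left_cancel₀ h1
    have h2 : (x ^ 2 - 1) ^ 2 = x ^ 2 * ((a : ℝ) ^ 2 - 4) := by
      linear_combination (-(x * a) - (x ^ 2 + 1)) * hx
    have h3 : ((x ^ (2 * m) - 1) * x) ^ 2 = ((x ^ 2 - 1) * x ^ m * q) ^ 2 := by rw [hq]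
    linear_combination x ^ 2 * key + h3 + (x ^ m) ^ 2 * q ^ 2 * h2
  · have he : ¬ Even n := Nat.not_even_iff_odd.2 ho
    obtain ⟨m, rfl⟩ := ho
    obtain ⟨q, hq⟩ := (exists_pow_odd_add_one hx m).1
    refine ⟨q, ?_⟩
    rw [cycleClass, if_neg he, ← Int.cast_inj (α := ℝ)]
    rw [Odd.neg_one_pow ⟨m, rfl⟩] at key
    push_cast [-Int.cast_det]
    have h1 : x ^ (2 * m + 1) ≠ 0 := by positivity
    apply mul_left_cancel₀ h1
    have h3 : (x ^ (2 * m + 1) + 1) ^ 2 = ((x + 1) * x ^ m * q) ^ 2 := by rw [hq]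
    linear_combination key + h3 - (x ^ m) ^ 2 * q ^ 2 * hx

/-! ### Positive definiteness, hence nondegeneracy. -/

section PosDef

open Matrix

theorem map_cycleMatrix_eq_add_mul_transpose {n : ℕ} (hn : 2 ≤ n) (a : ℤ) :
    (cycleMatrix n a).map (Int.cast : ℤ → ℝ) =
      ((a : ℝ) - 2) • (1 : Matrix (Fin n) (Fin n) ℝ) +
        (1 + shiftMatrix ℝ n) * (1 + shiftMatrix ℝ n)ᵀ := by
  rw [map_cycleMatrix hn, transpose_add, transpose_one, Matrix.add_mul, Matrix.mul_add,
    Matrix.mul_add, shiftMatrix_mul_transpose, Matrix.one_mul, Matrix.one_mul, Matrix.mul_one]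
  module

theorem posDef_smul_one_add_mul_transpose {ι : Type*} [Fintype ι] [DecidableEq ι] {r : ℝ}
    (hr : 0 < r) (N : Matrix ι ι ℝ) : (r • (1 : Matrix ι ι ℝ) + N * Nᵀ).PosDef := by
  refine (PosDef.one.smul hr).add_posSemidef ?_
  rw [← conjTranspose_eq_transpose_of_trivial]
  exact posSemidef_self_mul_conjTranspose N

theorem posDef_cycleMatrix {n : ℕ} (hn : 2 ≤ n) {a : ℤ} (ha : 2 < a) :
    ((cycleMatrix n a).map (Int.cast : ℤ → ℝ)).PosDef := by
  rw [map_cycleMatrix_eq_add_mul_transpose hn]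
  have ha' : (2 : ℝ) < a := by exact_mod_cast ha
  exact posDef_smul_one_add_mul_transpose (by linarith) _

theorem posDef_blockDiagonal_cycleMatrix {t : ℕ} {c : Fin t → ℕ} (hc : ∀ i, 2 ≤ c i) {a : ℤ}
    (ha : 2 < a) :
    ((blockDiagonal' fun i => cycleMatrix (c i) a).map (Int.cast : ℤ → ℝ)).PosDef := by
  have ha' : (2 : ℝ) < a := by exact_mod_cast ha
  have h1 : (blockDiagonal' fun i => cycleMatrix (c i) a).map (Int.cast : ℤ → ℝ) =
      ((a : ℝ) - 2) • (1 : Matrix ((i : Fin t) × Fin (c i)) _ ℝ) +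
        (blockDiagonal' fun i => 1 + shiftMatrix ℝ (c i)) *
          (blockDiagonal' fun i => 1 + shiftMatrix ℝ (c i))ᵀ := by
    rw [blockDiagonal'_map _ _ Int.cast_zero, blockDiagonal'_transpose, ← blockDiagonal'_mul,
      ← blockDiagonal'_one, ← blockDiagonal'_smul, ← blockDiagonal'_add]
    congr 1
    funext i
    exact map_cycleMatrix_eq_add_mul_transpose (hc i) a
  rw [h1]
  exact posDef_smul_one_add_mul_transpose (by linarith) _

theorem natMinor_pos_of_posDef {n : ℕ} {A : Matrix (Fin n) (Fin n) ℤ}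
    (hA : (A.map (Int.cast : ℤ → ℝ)).PosDef) {i : ℕ} (hi : i ≤ n) :
    0 < natMinor (natExtend (A.map (Int.cast : ℤ → ℚ))) i := by
  rw [← leadingMinor_eq_natMinor _ i hi]
  have h1 := (hA.submatrix (Fin.castLE_injective hi)).det_pos
  rw [leadingMinor]
  rw [submatrix_map, ← Int.cast_det] at h1 ⊢
  exact_mod_cast h1

theorem isNondegenerate_of_posDef {n : ℕ} {A : Matrix (Fin n) (Fin n) ℤ}
    (hA : (A.map (Int.cast : ℤ → ℝ)).PosDef) :
    IsNondegenerate (A.map (Int.cast : ℤ → ℚ)) := fun i hi _ => by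
  rw [leadingMinor_eq_natMinor]
  exact (natMinor_pos_of_posDef hA hi).ne'

theorem posDef_coveringMatrix {k l t : ℕ} {c : Fin t → ℕ} (hc : ∀ i, 2 ≤ c i) (hlk : l + 2 < k) :
    ((coveringMatrix k l c).map (Int.cast : ℤ → ℝ)).PosDef := by
  have h1 : (coveringMatrix k l c).map (Int.cast : ℤ → ℝ) =
      ((blockDiagonal' fun i => cycleMatrix (c i) ((k : ℤ) - l)).map
        (Int.cast : ℤ → ℝ)).submatrix finSigmaFinEquiv.symm finSigmaFinEquiv.symm +
      (l : ℝ) • vecMulVec 1 (star 1) := by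
    ext i j
    simp [coveringMatrix]
  rw [h1]
  refine ((posDef_blockDiagonal_cycleMatrix hc (by omega)).submatrix
    (Equiv.injective _)).add_posSemidef ?_
  exact (posSemidef_vecMulVec_self_star _).smul (Nat.cast_nonneg l)

end PosDef

/-! ### The invariant of a translate with square determinant. -/

namespace IsRatSymbol

variable {h : ℚ → ℚ → ℤ}

theorem pow_left (H : IsRatSymbol h) {x y : ℚ} (hx : x ≠ 0) (hy : y ≠ 0) (n : ℕ) :
    h (x ^ n) y = h x y ^ n := by
  induction n with
  | zero => simpa using H.one_left hy
  | succ n ih => rw [pow_succ, pow_succ, H.mul_left (pow_ne_zero _ hx) hx hy, ih]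

/-- The invariants of a symmetric matrix and of its translate by the constant `l`, if the
latter has a square determinant. -/
theorem hasseSeq_add_const (H : IsRatSymbol h) {M : ℕ → ℕ → ℚ} {n : ℕ} {l r : ℚ} (hl : l ≠ 0)
    (hs : ∀ a < n, ∀ b < n, M a b = M b a) (hM : ∀ i ≤ n, natMinor M i ≠ 0)
    (hX : ∀ i ≤ n, natMinor (fun a b => M a b + l) i ≠ 0)
    (hr : natMinor (fun a b => M a b + l) n = r ^ 2) :
    hasseSeq h (natMinor fun a b => M a b + l) n =
      hasseSeq h (natMinor M) n * h (-l) (natMinor M n) := by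
  have n1 : (-1 : ℚ) ≠ 0 := by norm_num
  have key := H.hasseSeq_rank_one hl (natMinor_zero M) (natMinor_zero _) hM hX fun i hi =>
    exists_sq_natMinor_add_const (fun a ha b hb => hs a (by omega) b (by omega)) (hM i hi.le)
      (hM (i + 1) hi) l
  have hD := hM n le_rfl
  have r0 : r ≠ 0 := by
    rintro rfl
    exact hX n le_rfl (by rw [hr]; norm_num)
  have r1 := pow_ne_zero 2 r0
  have hlD := mul_ne_zero hl hD
  -- With `D` the determinant of `M`, the symbol on the left becomes `h (-1) (l * D)`, and `h (-D) l
  -- * h (-1) (l * D) = h (-l) D`.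
  rw [hr, neg_eq_neg_one_mul, H.mul_sq_left n1 (mul_ne_zero hlD r1) r0, H.symm,
    H.mul_sq_left hlD n1 r0, H.symm, H.mul_right n1 hl hD, H.neg_left hD hl,
    H.symm (natMinor M n) l] at key
  rw [H.neg_left hl hD]
  have b1 := H.mul_self n1 hD
  have b2 := H.mul_self n1 hl
  generalize h (-1) l = s1 at *
  generalize h (-1) (natMinor M n) = s2 at *
  generalize hasseSeq h (natMinor fun a b => M a b + l) n = Z at *
  linear_combination s1 * s2 * key - Z * s2 * s2 * b2 - Z * b1 +
    hasseSeq h (natMinor M) n * s2 * h l (natMinor M n) * b2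

end IsRatSymbol

/-! ### Block diagonal matrices. -/

/-- The number of even members of a family. -/
def evenCount {t : ℕ} (c : Fin t → ℕ) : ℕ := ∑ i, if Even (c i) then 1 else 0

/-- The number of odd members of a family. -/
def oddCount {t : ℕ} (c : Fin t → ℕ) : ℕ := ∑ i, if Even (c i) then 0 else 1

theorem evenCount_add_oddCount {t : ℕ} (c : Fin t → ℕ) : evenCount c + oddCount c = t := by
  rw [evenCount, oddCount, ← Finset.sum_add_distrib]
  rw [Finset.sum_congr rfl fun i _ => show _ = 1 by split_ifs <;> rfl]
  simp

theorem evenCount_castSucc {t : ℕ} (c : Fin (t + 1) → ℕ) :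
    evenCount c = evenCount (fun i : Fin t => c i.castSucc) +
      if Even (c (Fin.last t)) then 1 else 0 := Fin.sum_univ_castSucc _

theorem oddCount_castSucc {t : ℕ} (c : Fin (t + 1) → ℕ) :
    oddCount c = oddCount (fun i : Fin t => c i.castSucc) +
      if Even (c (Fin.last t)) then 0 else 1 := Fin.sum_univ_castSucc _

/-- The product of the pairwise symbols of `o` copies of `x` and `e` copies of `y`. -/
def pairProd (h : ℚ → ℚ → ℤ) (x y : ℚ) (o e : ℕ) : ℤ :=
  h x (-1) ^ o.choose 2 * h y (-1) ^ e.choose 2 * h x y ^ (e * o)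

/-- The new copy of `x` is paired with all earlier members at once; `h x x = h x (-1)` produces the
binomial exponent. -/
theorem pairProd_succ_left {h : ℚ → ℚ → ℤ} (H : IsRatSymbol h) {x y : ℚ} (hx : x ≠ 0)
    (hy : y ≠ 0) (o e : ℕ) :
    pairProd h x y (o + 1) e = pairProd h x y o e * h (x ^ o * y ^ e) x := by
  rw [H.mul_left (pow_ne_zero _ hx) (pow_ne_zero _ hy) hx, H.pow_left hx hx, H.pow_left hy hx,
    H.self hx, H.symm (-1), H.symm y x, pairProd, pairProd, Nat.choose_succ_succ' o 1,
    Nat.choose_one_right]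
  ring

theorem pairProd_succ_right {h : ℚ → ℚ → ℤ} (H : IsRatSymbol h) {x y : ℚ} (hx : x ≠ 0)
    (hy : y ≠ 0) (o e : ℕ) :
    pairProd h x y o (e + 1) = pairProd h x y o e * h (x ^ o * y ^ e) y := by
  rw [H.mul_left (pow_ne_zero _ hx) (pow_ne_zero _ hy) hy, H.pow_left hx hy, H.pow_left hy hy,
    H.self hy, H.symm (-1), pairProd, pairProd, Nat.choose_succ_succ' e 1,
    Nat.choose_one_right]
  ring

/-- `M` continues the block diagonal matrix with the blocks `B i`. -/
def IsBlockDiagonal (M : ℕ → ℕ → ℚ) {t : ℕ} {c : Fin t → ℕ}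
    (B : ∀ i, Matrix (Fin (c i)) (Fin (c i)) ℚ) : Prop :=
  ∀ x y : (i : Fin t) × Fin (c i),
    M (finSigmaFinEquiv x) (finSigmaFinEquiv y) = Matrix.blockDiagonal' B x y

namespace IsBlockDiagonal

variable {M : ℕ → ℕ → ℚ} {t : ℕ} {c : Fin (t + 1) → ℕ}
  {B : ∀ i, Matrix (Fin (c i)) (Fin (c i)) ℚ}

theorem finSigmaFinEquiv_castSucc (x : (i : Fin t) × Fin (c i.castSucc)) :
    (finSigmaFinEquiv (n := c) ⟨x.1.castSucc, x.2⟩ : ℕ) =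
      finSigmaFinEquiv (n := fun i : Fin t => c i.castSucc) x := by
  rw [finSigmaFinEquiv_apply, finSigmaFinEquiv_apply]
  rfl

theorem finSigmaFinEquiv_last (b : Fin (c (Fin.last t))) :
    (finSigmaFinEquiv (n := c) ⟨Fin.last t, b⟩ : ℕ) = ∑ i : Fin t, c i.castSucc + b := by
  rw [finSigmaFinEquiv_apply]
  rfl

theorem castSucc (hM : IsBlockDiagonal M B) :
    IsBlockDiagonal M (c := fun i : Fin t => c i.castSucc) fun i => B i.castSucc := by
  intro x y
  rw [← finSigmaFinEquiv_castSucc, ← finSigmaFinEquiv_castSucc, hM]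
  obtain ⟨i, a⟩ := x
  obtain ⟨j, b⟩ := y
  by_cases hij : i = j
  · subst hij
    rw [Matrix.blockDiagonal'_apply_eq, Matrix.blockDiagonal'_apply_eq]
  · rw [Matrix.blockDiagonal'_apply_ne _ _ _ hij, Matrix.blockDiagonal'_apply_ne]
    exact fun h => hij (Fin.castSucc_injective _ h)

theorem last (hM : IsBlockDiagonal M B) (a b : Fin (c (Fin.last t))) :
    M (∑ i : Fin t, c i.castSucc + a) (∑ i : Fin t, c i.castSucc + b) = B (Fin.last t) a b := by
  rw [← finSigmaFinEquiv_last, ← finSigmaFinEquiv_last, hM, Matrix.blockDiagonal'_apply_eq]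

theorem castSucc_last (hM : IsBlockDiagonal M B) {a : ℕ} (ha : a < ∑ i : Fin t, c i.castSucc)
    {b : ℕ} (hb : b < c (Fin.last t)) : M a (∑ i : Fin t, c i.castSucc + b) = 0 := by
  obtain ⟨x, hx⟩ := finSigmaFinEquiv.surjective (⟨a, ha⟩ : Fin (∑ i : Fin t, c i.castSucc))
  have e1 : a = (finSigmaFinEquiv (n := c) ⟨x.1.castSucc, x.2⟩ : ℕ) := by
    rw [finSigmaFinEquiv_castSucc]
    exact (congrArg Fin.val hx).symm
  have e2 := finSigmaFinEquiv_last (c := c) ⟨b, hb⟩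
  rw [e1, ← e2, hM, Matrix.blockDiagonal'_apply_ne]
  exact Fin.castSucc_ne_last _

theorem natMinor_sum_add (hM : IsBlockDiagonal M B) {m : ℕ} (hm : m ≤ c (Fin.last t)) :
    natMinor M (∑ i : Fin t, c i.castSucc + m) =
      natMinor M (∑ i : Fin t, c i.castSucc) * natMinor (natExtend (B (Fin.last t))) m := by
  rw [natMinor_add fun a ha b hb => hM.castSucc_last ha (by omega)]
  congr 1
  refine natMinor_congr fun a ha b hb => ?_
  have := hM.last ⟨a, by omega⟩ ⟨b, by omega⟩
  exact this.trans (natExtend_val (B (Fin.last t)) _ _).symm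

end IsBlockDiagonal

theorem cycleClass_ne_zero (n : ℕ) {a : ℤ} (ha : 2 < a) : (cycleClass n a : ℚ) ≠ 0 := by
  rw [Int.cast_ne_zero, cycleClass]
  split_ifs <;> nlinarith

/-- The determinant and the invariant of a block diagonal matrix of cycle matrices. -/
theorem hasseSeq_of_isBlockDiagonal (p : RatPlace) {a : ℤ} (ha : 2 < a) {t : ℕ} {c : Fin t → ℕ}
    (hc : ∀ i, 2 ≤ c i) {M : ℕ → ℕ → ℚ}
    (hM : IsBlockDiagonal M fun i => (cycleMatrix (c i) a).map (Int.cast : ℤ → ℚ)) :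
    (∃ q : ℚ, q ≠ 0 ∧ natMinor M (∑ i, c i) =
      ((a : ℚ) + 2) ^ oddCount c * ((a : ℚ) ^ 2 - 4) ^ evenCount c * q ^ 2) ∧
    IsRatSymbol.hasseSeq (hilbertSymbolRat p) (natMinor M) (∑ i, c i) =
      hilbertSymbolRat p (-1) (-1) ^ (t + 1) *
        pairProd (hilbertSymbolRat p) ((a : ℚ) + 2) ((a : ℚ) ^ 2 - 4) (oddCount c)
          (evenCount c) *
        ∏ i, hasseMinkowski p ((cycleMatrix (c i) a).map (Int.cast : ℤ → ℚ)) := by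
  have H := hilbertSymbolRat_isRatSymbol p
  have ha' : (2 : ℚ) < a := by exact_mod_cast ha
  have hx : (a : ℚ) + 2 ≠ 0 := by linarith
  have hy : (a : ℚ) ^ 2 - 4 ≠ 0 := by nlinarith
  induction t with
  | zero =>
    -- The empty form has `hasseSeq` equal to `(-1,-1)_p`, hence the exponent `t + 1`.
    exact ⟨⟨1, one_ne_zero, by simp [oddCount, evenCount, natMinor_zero]⟩,
      by simp [oddCount, evenCount, IsRatSymbol.hasseSeq, pairProd]⟩
  | succ t ih =>
    obtain ⟨⟨q, hq, hdet⟩, hh⟩ := ih (fun i => hc i.castSucc) hM.castSucc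
    have hcl := hc (Fin.last t)
    have hpos := fun {i : ℕ} (hi : i ≤ c (Fin.last t)) =>
      (natMinor_pos_of_posDef (posDef_cycleMatrix hcl ha) hi).ne'
    obtain ⟨r, hr⟩ := exists_det_cycleMatrix hcl ha
    have hmin : natMinor (natExtend ((cycleMatrix (c (Fin.last t)) a).map (Int.cast : ℤ → ℚ)))
        (c (Fin.last t)) = cycleClass (c (Fin.last t)) a * (r : ℚ) ^ 2 := by
      rw [natMinor_natExtend, ← Int.cast_det, hr]
      norm_cast
    have r0 : (r : ℚ) ≠ 0 := by
      intro h0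
      exact hpos le_rfl (by rw [hmin, h0]; ring)
    have k0 := cycleClass_ne_zero (c (Fin.last t)) ha
    have z0 : ((a : ℚ) + 2) ^ (oddCount fun i : Fin t => c i.castSucc) *
        ((a : ℚ) ^ 2 - 4) ^ (evenCount fun i : Fin t => c i.castSucc) ≠ 0 :=
      mul_ne_zero (pow_ne_zero _ hx) (pow_ne_zero _ hy)
    have hdet' : natMinor M (∑ i : Fin t, c i.castSucc) ≠ 0 := by
      rw [hdet]; exact mul_ne_zero z0 (pow_ne_zero _ hq)
    have hsym : hilbertSymbolRat p (natMinor M (∑ i : Fin t, c i.castSucc))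
        (natMinor (natExtend ((cycleMatrix (c (Fin.last t)) a).map (Int.cast : ℤ → ℚ)))
          (c (Fin.last t))) = hilbertSymbolRat p
        (((a : ℚ) + 2) ^ (oddCount fun i : Fin t => c i.castSucc) *
          ((a : ℚ) ^ 2 - 4) ^ (evenCount fun i : Fin t => c i.castSucc))
        (cycleClass (c (Fin.last t)) a) := by
      rw [hdet, hmin, H.mul_sq_left z0 (mul_ne_zero k0 (pow_ne_zero _ r0)) hq, H.symm,
        H.mul_sq_left k0 z0 r0, H.symm]
    rw [Fin.sum_univ_castSucc, hM.natMinor_sum_add le_rfl, H.hasseSeq_add (natMinor_zero _) hdet'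
      (fun i hi => hpos hi) (fun i hi => hM.natMinor_sum_add hi), hsym, hh,
      ← hasseMinkowski_eq_hasseSeq p (by omega) (fun i hi => hpos hi), hdet, hmin,
      Fin.prod_univ_castSucc, oddCount_castSucc, evenCount_castSucc]
    constructor
    · refine ⟨q * r, mul_ne_zero hq r0, ?_⟩
      unfold cycleClass
      split_ifs <;> (push_cast; ring)
    · unfold cycleClass
      split_ifs
      · push_cast
        rw [add_zero, pairProd_succ_right H hx hy]
        ring
      · push_cast
        rw [add_zero, pairProd_succ_left H hx hy]
        ring

/-! ### Assembly of the formula. -/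

/-- The exponents `t - 1` and `t + 1` of a sign agree in parity; `t ≠ 0` guards against truncated
subtraction. -/
theorem coveringFactor_eq (p : RatPlace) (a l : ℤ) {t e : ℕ} (ht : t ≠ 0) :
    coveringFactor p a l t e = hilbertSymbolRat p (-1) (-1) ^ (t + 1) *
      pairProd (hilbertSymbolRat p) ((a : ℚ) + 2) ((a : ℚ) ^ 2 - 4) (t - e) e *
      hilbertSymbolRat p (-l) (((a : ℚ) + 2) ^ t * ((a : ℚ) - 2) ^ e) := by
  have H := hilbertSymbolRat_isRatSymbol p
  have n1 : (-1 : ℚ) ≠ 0 := by norm_num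
  obtain ⟨s, rfl⟩ := Nat.exists_eq_succ_of_ne_zero ht
  simp only [coveringFactor, pairProd, ← hilbertSymbolRat_intCast]
  push_cast
  have b := H.mul_self n1 n1
  rw [pow_succ (hilbertSymbolRat p (-1) (-1)) (s + 1),
    pow_succ (hilbertSymbolRat p (-1) (-1)) s,
    mul_assoc (hilbertSymbolRat p (-1) (-1) ^ s) _ (hilbertSymbolRat p (-1) (-1)), b]
  ring

theorem cycleMatrix_symm (n : ℕ) (a : ℤ) (i j : Fin n) :
    cycleMatrix n a i j = cycleMatrix n a j i := by
  simp only [cycleMatrix, Matrix.of_apply, eq_comm (a := i)]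
  congr 3
  rw [eq_iff_iff]
  tauto

theorem mainTheorem7 (v k l : ℕ) (hl : 0 < l) (hlk : l + 2 < k) (hkv : k < v)
    (p : RatPlace) (t : ℕ) (c : Fin t → ℕ) (hc : ∀ i, 2 ≤ c i) (hv : ∑ i, c i = v)
    (e : ℕ) (he : e = (Finset.univ.filter fun i => Even (c i)).card)
    (hsq : IsSquare (coveringMatrix k l c).det) :
    IsNondegenerate ((coveringMatrix k l c).map (Int.cast : ℤ → ℚ)) ∧
    (∀ i, IsNondegenerate
      ((cycleMatrix (c i) ((k : ℤ) - (l : ℤ))).map (Int.cast : ℤ → ℚ))) ∧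
    hasseMinkowski p ((coveringMatrix k l c).map (Int.cast : ℤ → ℚ)) =
      coveringFactor p ((k : ℤ) - (l : ℤ)) (l : ℤ) t e *
        ∏ i, hasseMinkowski p
          ((cycleMatrix (c i) ((k : ℤ) - (l : ℤ))).map (Int.cast : ℤ → ℚ)) := by
  have hX := posDef_coveringMatrix (l := l) hc hlk
  have ha : 2 < (k : ℤ) - l := by omega
  refine ⟨isNondegenerate_of_posDef hX,
    fun i => isNondegenerate_of_posDef (posDef_cycleMatrix (hc i) ha), ?_⟩
  have H := hilbertSymbolRat_isRatSymbol p
  have hl' : (l : ℚ) ≠ 0 := by exact_mod_cast hl.ne'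
  have ht : t ≠ 0 := by
    rintro rfl
    simp at hv
    omega
  have hn : ∑ i, c i ≠ 0 := by omega
  -- The block diagonal part, of which `coveringMatrix` is the translate by the constant `l`.
  set B : Matrix (Fin (∑ i, c i)) (Fin (∑ i, c i)) ℤ :=
    (Matrix.blockDiagonal' fun i : Fin t => cycleMatrix (c i) ((k : ℤ) - l)).submatrix
      finSigmaFinEquiv.symm finSigmaFinEquiv.symm with hB
  have hBpos : (B.map (Int.cast : ℤ → ℝ)).PosDef :=
    (posDef_blockDiagonal_cycleMatrix hc ha).submatrix
      finSigmaFinEquiv.symm.injective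
  set M := natExtend (B.map (Int.cast : ℤ → ℚ)) with hM
  have hMval : ∀ {a b : ℕ} (ha : a < ∑ i, c i) (hb : b < ∑ i, c i),
      M a b = (B ⟨a, ha⟩ ⟨b, hb⟩ : ℚ) := fun ha hb =>
    natExtend_val (B.map (Int.cast : ℤ → ℚ)) ⟨_, ha⟩ ⟨_, hb⟩
  have hblock : IsBlockDiagonal M fun i =>
      (cycleMatrix (c i) ((k : ℤ) - l)).map (Int.cast : ℤ → ℚ) := by
    intro x y
    rw [hMval (finSigmaFinEquiv x).2 (finSigmaFinEquiv y).2, hB, Matrix.submatrix_apply,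
      ← Matrix.blockDiagonal'_map _ _ Int.cast_zero, Fin.eta, Fin.eta, Equiv.symm_apply_apply,
      Equiv.symm_apply_apply, Matrix.map_apply]
  have hsymm : ∀ a < ∑ i, c i, ∀ b < ∑ i, c i, M a b = M b a := by
    intro a ha b hb
    have hBT : B.transpose = B := by
      rw [hB, Matrix.transpose_submatrix, Matrix.blockDiagonal'_transpose]
      congr 2
      funext i
      ext x y
      exact cycleMatrix_symm _ _ _ _
    rw [hMval ha hb, hMval hb ha]
    exact congrArg _ (congrFun (congrFun hBT ⟨b, hb⟩) ⟨a, ha⟩)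
  have hXM : ∀ i ≤ ∑ i, c i, natMinor (natExtend ((coveringMatrix k l c).map
      (Int.cast : ℤ → ℚ))) i = natMinor (fun a b => M a b + l) i := by
    intro i hi
    refine natMinor_congr fun a ha b hb => ?_
    have e1 := natExtend_val ((coveringMatrix k l c).map (Int.cast : ℤ → ℚ))
      ⟨a, by omega⟩ ⟨b, by omega⟩
    rw [hMval (by omega) (by omega)]
    refine e1.trans ?_
    simp [coveringMatrix, hB]
  have hXpos := fun i hi => (natMinor_pos_of_posDef (i := i) hX hi).ne'
  obtain ⟨r, hr⟩ := hsq
  have hr' : natMinor (fun a b => M a b + l) (∑ i, c i) = (r : ℚ) ^ 2 := by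
    rw [← hXM _ le_rfl, natMinor_natExtend, ← Int.cast_det, hr]
    push_cast
    ring
  have hMpos := fun i hi => (natMinor_pos_of_posDef (i := i) hBpos hi).ne'
  obtain ⟨⟨q, hq, hdet⟩, hh⟩ := hasseSeq_of_isBlockDiagonal p ha hc hblock
  have hee : evenCount c = e := by rw [he, Finset.card_filter]; rfl
  have hoo : oddCount c = t - e := by
    have := evenCount_add_oddCount c
    omega
  have het : t = t - e + e := by
    have := evenCount_add_oddCount c
    omega
  have ha' : (2 : ℚ) < ((k : ℤ) - l : ℤ) := by exact_mod_cast ha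
  have hcls : natMinor M (∑ i, c i) = ((((k : ℤ) - l : ℤ) : ℚ) + 2) ^ t *
      ((((k : ℤ) - l : ℤ) : ℚ) - 2) ^ e * q ^ 2 := by
    rw [hdet, hee, hoo]
    -- Splitting `a² - 4 = (a + 2)(a - 2)` turns `(a + 2)^(t - e) (a² - 4)^e` into `(a + 2)^t (a -
    -- 2)^e`.
    have : (((k : ℤ) - l : ℤ) : ℚ) ^ 2 - 4 =
        ((((k : ℤ) - l : ℤ) : ℚ) + 2) * ((((k : ℤ) - l : ℤ) : ℚ) - 2) := by ring
    rw [this, mul_pow]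
    nth_rw 2 [het]
    rw [pow_add]
    ring
  rw [hasseMinkowski_eq_hasseSeq p hn hXpos, IsRatSymbol.hasseSeq_congr hXM,
    H.hasseSeq_add_const hl' hsymm hMpos (fun i hi => by rw [← hXM i hi]; exact hXpos i hi) hr',
    hh, hcls, H.symm (-(l : ℚ)), H.mul_sq_left _ (neg_ne_zero.2 hl') hq, H.symm _ (-(l : ℚ)),
    coveringFactor_eq p _ _ ht, hee, hoo]
  · push_cast
    ring
  · exact mul_ne_zero (pow_ne_zero _ (by linarith)) (pow_ne_zero _ (by linarith))
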